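/- Let $n\ge 0$, let $q\in\mathbb C^\times$ be not a root of unity, and let $M$ be the field of meromorphic functions on $\mathbb C^n$. With $q^{z}=e^{z\log q}$ (principal branch) put $$h(x)=q\,\frac{q^{-2x}-q^{-2}}{q^{-2x}-1},\qquad g(x)=h(x)h(-x).$$ Let $\mathscr F_R(M(n))$ be the associative unital $\mathbb C$-algebra generated by elements $t_{ij}$ ($1\le i,j\le n$) and two copies of the $\mathbb C$-algebra $M$, with elements written $f(\lambda)=\mu_l(f)$ and $f(\mu)=\mu_r(f)$, subject to $$f_1(\lambda)f_2(\mu)=f_2(\mu)f_1(\lambda),\quad f(\lambda)t_{ij}=t_{ij}f(\lambda+e_i),\quad f(\mu)t_{ij}=t_{ij}f(\mu+e_j),$$ $$h(\mu_k-\mu_l)t_{ik}t_{il}=t_{il}t_{ik}\ (k<l),\qquad h(\lambda_j-\lambda_i)t_{jk}t_{ik}=t_{ik}t_{jk}\ (i<j),$$ and, for $i<j$ and $k<l$, the four relations $$t_{ik}t_{jl}=t_{jl}t_{ik}+\bigl(h(\lambda_j-\lambda_i)-h(\mu_k-\mu_l)\bigr)t_{jk}t_{il},$$ $$g(\mu_k-\mu_l)t_{ik}t_{jl}=g(\lambda_i-\lambda_j)t_{jl}t_{ik}+\bigl(h(\mu_l-\mu_k)-h(\lambda_i-\lambda_j)\bigr)t_{il}t_{jk},$$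 $$t_{il}t_{jk}=g(\mu_k-\mu_l)t_{jk}t_{il}+\bigl(h(\mu_k-\mu_l)-h(\lambda_i-\lambda_j)\bigr)t_{jl}t_{ik},$$ $$t_{il}t_{jk}=g(\lambda_i-\lambda_j)t_{jk}t_{il}+\bigl(h(\mu_k-\mu_l)-h(\lambda_i-\lambda_j)\bigr)t_{ik}t_{jl}.$$ For $\pi\in S_n$ and disjoint $I_1,I_2\subseteq\{1,\dots,n\}$ define elements of $M$ by $$S(\pi)(\lambda)=\prod_{k<l,\ \pi(k)>\pi(l)}\bigl(-h(\lambda_{\pi(k)}-\lambda_{\pi(l)})\bigr),\qquad \mathrm{sign}(I_1;I_2)(\lambda)=\prod_{k\in I_1,\,l\in I_2,\,k>l}\bigl(-h(\lambda_k-\lambda_l)\bigr).$$ The dynamical quantum determinant is $$\det(T)=\mu_r\bigl(S(\rho)^{-1}\bigr)\sum_{\pi\in S_n}\mu_l\bigl(S(\pi)\bigr)\,t_{\pi(1)\rho(1)}\cdots t_{\pi(n)\rho(n)},$$ where $\rho\in S_n$ may be any permutation; the statement below holds for every choice of $\rho$. If $X$ is a square matrix over a ring that has a two-sided inverse, and the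 entry $(X^{-1})_{ji}$ is invertible, the quasideterminant $|X|_{ij}$ is defined to be $\bigl((X^{-1})_{ji}\bigr)^{-1}$; for a $1\times1$ matrix it is the entry itself, provided that the entry is invertible. Let $\sigma=i_1\cdots i_n$ and $\tau=j_1\cdots j_n$ be permutations of $\{1,\dots,n\}$, and put $I_k=\{i_1,\dots,i_k\}$, $J_k=\{j_1,\dots,j_k\}$. Let $K$ be a ring with a ring homomorphism $\mathscr F_R(M(n))\to K$, and let $T=(t_{ij})$ be regarded as a matrix over $K$. For $1\le k\le n$ let $T^{i_1\cdots i_{k-1},\,j_1\cdots j_{k-1}}$ be $T$ with rows $i_1,\dots,i_{k-1}$ and columns $j_1,\dots,j_{k-1}$ deleted. (a) If every nonzero element of $\mathscr F_R(M(n))$ becomes invertible in $K$ (as in the ring of fractions of $\mathscr F_R(M(n))$), then the quasideterminants $|T^{i_1\cdots i_{k-1},\,j_1\cdots j_{k-1}}|_{i_kj_k}$, $1\le k\le n$, are all defined. (b) Whenever these quasideterminants are all defined (in particular, in the ring of fractions of $\mathscr F_R(M(n))$), one has in $K$ $$\det(T)=\frac{\prod_{k=1}^n\mu_l\bigl(\mathrm{sign}(I_k^c;\{i_k\})\bigr)}{\prod_{k=1}^n\mu_r\bigl(\mathrm{sign}(J_k^c;\{j_k\})\bigr)}\;t_{i_nj_n}\cdots|T^{i_1j_1}|_{i_2j_2}\,|T|_{i_1j_1},$$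 that is, the prefactor times the product of the quasideterminants $|T^{i_1\cdots i_{k-1},\,j_1\cdots j_{k-1}}|_{i_kj_k}$ in the order $k=n,n-1,\dots,1$ from left to right, the factor for $k=n$ being $t_{i_nj_n}$. -/

import Mathlib

namespace DynDet

noncomputable section

/-! ### The field of meromorphic functions on `ℂⁿ` and its shifts -/

/-- The ring of entire functions on `ℂⁿ`. -/
def Entire (n : ℕ) : Subalgebra ℂ ((Fin n → ℂ) → ℂ) where
  carrier := {f | AnalyticOnNhd ℂ f Set.univ}
  mul_mem' hf hg := AnalyticOnNhd.mul hf hg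
  add_mem' hf hg := AnalyticOnNhd.add hf hg
  algebraMap_mem' _ := analyticOnNhd_const

instance instNoZeroDivisorsEntire (n : ℕ) : NoZeroDivisors (Entire n) where
  eq_zero_or_eq_zero_of_mul_eq_zero := by
    rintro ⟨f, hf⟩ ⟨g, hg⟩ h
    have hfg : ∀ z, f z * g z = 0 := fun z => congrFun (congrArg Subtype.val h) z
    by_cases hf0 : f = 0
    · left; exact Subtype.ext hf0
    · right
      obtain ⟨z₀, hz₀⟩ : ∃ z, f z ≠ 0 := by
        by_contra hc
        push Not at hc
        exact hf0 (funext hc)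
      have hev : ∀ᶠ z in nhds z₀, f z ≠ 0 :=
        ((hf z₀ (Set.mem_univ _)).continuousAt).eventually_ne hz₀
      have hg0 : g =ᶠ[nhds z₀] 0 := by
        filter_upwards [hev] with z hz
        exact (mul_eq_zero.mp (hfg z)).resolve_left hz
      have := AnalyticOnNhd.eqOn_zero_of_preconnected_of_eventuallyEq_zero hg
        isPreconnected_univ (Set.mem_univ z₀) hg0
      exact Subtype.ext (funext fun z => this (Set.mem_univ z))

instance instNontrivialEntire (n : ℕ) : Nontrivial (Entire n) :=
  ⟨0, 1, fun h => zero_ne_one (α := ℂ) (congrFun (congrArg Subtype.val h) 0)⟩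

instance instIsDomainEntire (n : ℕ) : IsDomain (Entire n) := NoZeroDivisors.to_isDomain _

/-- The field of meromorphic functions on `ℂⁿ`: by the Poincaré–Cousin theorem, every meromorphic
function on `ℂⁿ` is a quotient of two entire functions. -/
abbrev Mero (n : ℕ) : Type := FractionRing (Entire n)

/-- Translation by `v` on entire functions: `f ↦ (z ↦ f (z + v))`. -/
def translate {n : ℕ} (v : Fin n → ℂ) (f : Entire n) : Entire n :=
  ⟨fun z => f.1 (z + v), fun z _ =>
    AnalyticAt.fun_comp (f := fun z => z + v) (f.2 (z + v) (Set.mem_univ _))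
      (analyticAt_id.add analyticAt_const)⟩

/-- Translation by `v` as an automorphism of the ring of entire functions. -/
def translateEquiv {n : ℕ} (v : Fin n → ℂ) : Entire n ≃+* Entire n where
  toFun := translate v
  invFun := translate (-v)
  left_inv f := Subtype.ext (funext fun z => congrArg f.1 (by simp))
  right_inv f := Subtype.ext (funext fun z => congrArg f.1 (by simp))
  map_mul' _ _ := rfl
  map_add' _ _ := rfl

/-- The shift `f(λ) ↦ f(λ + ω(i))` of meromorphic functions, where `ω(i)` is the `i`-th basis
vector. -/
def shift {n : ℕ} (i : Fin n) : Mero n ≃+* Mero n :=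
  IsFractionRing.ringEquivOfRingEquiv (translateEquiv (Pi.single i (1 : ℂ)))

/-! ### The functions `h` and `g` -/

/-- The entire function `q^{-2(λ_a - λ_b)}` of `λ`, for the principal branch of `log q`. -/
def qexp {n : ℕ} (q : ℂ) (a b : Fin n) : Entire n :=
  ⟨fun z => Complex.exp (-2 * (z a - z b) * Complex.log q), fun z _ => by
    have hp : ∀ c : Fin n, AnalyticAt ℂ (fun z : Fin n → ℂ => z c) z := fun c =>
      (ContinuousLinearMap.proj (R := ℂ) (φ := fun _ : Fin n => ℂ) c).analyticAt z
    exact ((analyticAt_const.mul ((hp a).sub (hp b))).mul analyticAt_const).cexp⟩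

/-- `h(λ_a - λ_b)`, where `h(x) = q (q^{-2x} - q^{-2}) / (q^{-2x} - 1)`. -/
def hfun {n : ℕ} (q : ℂ) (a b : Fin n) : Mero n :=
  algebraMap ℂ (Mero n) q *
    (algebraMap (Entire n) (Mero n) (qexp q a b) - algebraMap ℂ (Mero n) (q ^ (-2 : ℤ))) /
    (algebraMap (Entire n) (Mero n) (qexp q a b) - 1)

/-- `g(λ_a - λ_b)`, where `g(x) = h(x) h(-x)`. -/
def gfun {n : ℕ} (q : ℂ) (a b : Fin n) : Mero n := hfun q a b * hfun q b a

/-! ### The dynamical quantum matrix algebra -/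

/-- Generators: the `t_{ij}` and two copies `f(λ)`, `f(μ)` of the meromorphic functions. -/
inductive Gen (n : ℕ) : Type
  | t (i j : Fin n) : Gen n
  | lam (f : Mero n) : Gen n
  | mu (f : Mero n) : Gen n

/-- The generator `t_{ij}` in the free algebra. -/
abbrev ft {n : ℕ} (i j : Fin n) : FreeAlgebra ℂ (Gen n) := FreeAlgebra.ι ℂ (Gen.t i j)

/-- The generator `f(λ)` in the free algebra. -/
abbrev fl {n : ℕ} (f : Mero n) : FreeAlgebra ℂ (Gen n) := FreeAlgebra.ι ℂ (Gen.lam f)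

/-- The generator `f(μ)` in the free algebra. -/
abbrev fm {n : ℕ} (f : Mero n) : FreeAlgebra ℂ (Gen n) := FreeAlgebra.ι ℂ (Gen.mu f)

/-- The defining relations of the dynamical quantum matrix algebra. `rtt₁`, …, `rtt₄` are the four
components, for two rows `i < j` and two columns `k < l`, of the dynamical `RTT` relation. The last
two follow from `rtt₁` and `rtt₂` after division by `h(λ_j - λ_i) - h(μ_k - μ_l)`, which is not
invertible in the tensor product of the two copies of the meromorphic functions. -/
inductive Rel {n : ℕ} (q : ℂ) : FreeAlgebra ℂ (Gen n) → FreeAlgebra ℂ (Gen n) → Prop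
  /- both copies of the meromorphic functions are `ℂ`-subalgebras -/
  | lam_scalar (c : ℂ) :
      Rel q (fl (algebraMap ℂ (Mero n) c)) (algebraMap ℂ (FreeAlgebra ℂ (Gen n)) c)
  | lam_add (f₁ f₂ : Mero n) : Rel q (fl (f₁ + f₂)) (fl f₁ + fl f₂)
  | lam_mul (f₁ f₂ : Mero n) : Rel q (fl (f₁ * f₂)) (fl f₁ * fl f₂)
  | mu_scalar (c : ℂ) :
      Rel q (fm (algebraMap ℂ (Mero n) c)) (algebraMap ℂ (FreeAlgebra ℂ (Gen n)) c)
  | mu_add (f₁ f₂ : Mero n) : Rel q (fm (f₁ + f₂)) (fm f₁ + fm f₂)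
  | mu_mul (f₁ f₂ : Mero n) : Rel q (fm (f₁ * f₂)) (fm f₁ * fm f₂)
  /- commutation of functions with functions and with the `t_{ij}` -/
  | lam_mu (f₁ f₂ : Mero n) : Rel q (fl f₁ * fm f₂) (fm f₂ * fl f₁)
  | lam_t (f : Mero n) (i j : Fin n) : Rel q (fl f * ft i j) (ft i j * fl (shift i f))
  | mu_t (f : Mero n) (i j : Fin n) : Rel q (fm f * ft i j) (ft i j * fm (shift j f))
  /- quadratic relations -/
  | rows (i k l : Fin n) (hkl : k < l) :
      Rel q (fm (hfun q k l) * (ft i k * ft i l)) (ft i l * ft i k)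
  | cols (i j k : Fin n) (hij : i < j) :
      Rel q (fl (hfun q j i) * (ft j k * ft i k)) (ft i k * ft j k)
  | rtt₁ (i j k l : Fin n) (hij : i < j) (hkl : k < l) :
      Rel q (ft i k * ft j l)
        (ft j l * ft i k + (fl (hfun q j i) - fm (hfun q k l)) * (ft j k * ft i l))
  | rtt₂ (i j k l : Fin n) (hij : i < j) (hkl : k < l) :
      Rel q (fm (gfun q k l) * (ft i k * ft j l))
        (fl (gfun q i j) * (ft j l * ft i k)
          + (fm (hfun q l k) - fl (hfun q i j)) * (ft i l * ft j k))
  | rtt₃ (i j k l : Fin n) (hij : i < j) (hkl : k < l) :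
      Rel q (ft i l * ft j k)
        (fm (gfun q k l) * (ft j k * ft i l)
          + (fm (hfun q k l) - fl (hfun q i j)) * (ft j l * ft i k))
  | rtt₄ (i j k l : Fin n) (hij : i < j) (hkl : k < l) :
      Rel q (ft i l * ft j k)
        (fl (gfun q i j) * (ft j k * ft i l)
          + (fm (hfun q k l) - fl (hfun q i j)) * (ft i k * ft j l))

/-- The dynamical quantum matrix algebra `F_R(M(n))`. -/
abbrev DynAlg (n : ℕ) (q : ℂ) : Type := RingQuot (Rel (n := n) q)

/-- The generator `t_{ij}` of `F_R(M(n))`. -/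
def t {n : ℕ} (q : ℂ) (i j : Fin n) : DynAlg n q := RingQuot.mkAlgHom ℂ (Rel q) (ft i j)

/-- The moment map `μ_l(f) = f(λ)`. -/
def momL {n : ℕ} (q : ℂ) (f : Mero n) : DynAlg n q := RingQuot.mkAlgHom ℂ (Rel q) (fl f)

/-- The moment map `μ_r(f) = f(μ)`. -/
def momR {n : ℕ} (q : ℂ) (f : Mero n) : DynAlg n q := RingQuot.mkAlgHom ℂ (Rel q) (fm f)

/-! ### Sign functions and the determinant -/

/-- The generalized sign function
`S(σ)(λ) = ∏_{k < l, σ(k) > σ(l)} (-h(λ_{σ(k)} - λ_{σ(l)}))` of a permutation of `{1, …, n}`. -/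
def genSign {n : ℕ} (q : ℂ) (σ : Equiv.Perm (Fin n)) : Mero n :=
  ∏ k : Fin n, ∏ l : Fin n with k < l ∧ σ l < σ k, -hfun q (σ k) (σ l)

/-- `sign(I₁; I₂)(λ) = ∏_{k ∈ I₁, l ∈ I₂, k > l} (-h(λ_k - λ_l))`. -/
def qsign {n : ℕ} (q : ℂ) (I₁ I₂ : Finset (Fin n)) : Mero n :=
  ∏ k ∈ I₁, ∏ l ∈ I₂ with l < k, -hfun q k l

/-- The dynamical quantum determinant, computed with the auxiliary permutation `ρ`:
`μ_r(S(ρ))⁻¹ ∑_σ μ_l(S(σ)) t_{σ(1)ρ(1)} ⋯ t_{σ(n)ρ(n)}`. -/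
def dynDet {n : ℕ} (q : ℂ) (ρ : Equiv.Perm (Fin n)) : DynAlg n q :=
  momR q (genSign q ρ)⁻¹ *
    ∑ σ : Equiv.Perm (Fin n),
      momL q (genSign q σ) * (List.ofFn fun k : Fin n => t q (σ k) (ρ k)).prod

/-! ### Quasideterminants -/

/-- `x` is the quasideterminant `|X|_{ij}`: the square matrix `X` (rows indexed by `ι`, columns by
`κ`) has an inverse matrix `Y`, the entry `Y_{ji}` is invertible, and `x` is its inverse. -/
def IsQuasidet {K ι κ : Type*} [Ring K] [Fintype ι] [Fintype κ] [DecidableEq ι] [DecidableEq κ]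
    (X : Matrix ι κ K) (i : ι) (j : κ) (x : K) : Prop :=
  ∃ Y : Matrix κ ι K, X * Y = 1 ∧ Y * X = 1 ∧ Y j i * x = 1 ∧ x * Y j i = 1

/-- `{σ(k), σ(k+1), …, σ(n)}`: what is left after deleting `σ(1), …, σ(k-1)`. -/
def remaining {n : ℕ} (σ : Equiv.Perm (Fin n)) (k : Fin n) : Finset (Fin n) :=
  (Finset.Ici k).map σ.toEmbedding

theorem mem_remaining {n : ℕ} (σ : Equiv.Perm (Fin n)) (k : Fin n) : σ k ∈ remaining σ k :=
  Finset.mem_map_of_mem _ (Finset.mem_Ici.mpr le_rfl)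

/-- `I_k = {σ(1), …, σ(k)}`. -/
def initialSet {n : ℕ} (σ : Equiv.Perm (Fin n)) (k : Fin n) : Finset (Fin n) :=
  (Finset.Iic k).map σ.toEmbedding

/-- The image in `K` of the matrix `T` of generators with rows `σ(1), …, σ(k-1)` and columns
`τ(1), …, τ(k-1)` deleted. -/
def deletedMatrix {n : ℕ} {q : ℂ} {K : Type*} [Ring K] (φ : DynAlg n q →+* K)
    (σ τ : Equiv.Perm (Fin n)) (k : Fin n) :
    Matrix {a // a ∈ remaining σ k} {b // b ∈ remaining τ k} K :=
  Matrix.of fun a b => φ (t q a.1 b.1)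

/-- `d` is the `k`-th quasideterminant `|T^{i_1 … i_{k-1}, j_1 … j_{k-1}}|_{i_k j_k}` over `K`. -/
def IsStepQuasidet {n : ℕ} {q : ℂ} {K : Type*} [Ring K] (φ : DynAlg n q →+* K)
    (σ τ : Equiv.Perm (Fin n)) (k : Fin n) (d : K) : Prop :=
  IsQuasidet (deletedMatrix φ σ τ k) ⟨σ k, mem_remaining σ k⟩ ⟨τ k, mem_remaining τ k⟩ d

/-- The prefactor
`∏_k μ_l(sign(I_kᶜ; i_k)) / ∏_k μ_r(sign(J_kᶜ; j_k))`. -/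
def prefactor {n : ℕ} (q : ℂ) (σ τ : Equiv.Perm (Fin n)) : DynAlg n q :=
  momL q (∏ k : Fin n, qsign q (initialSet σ k)ᶜ {σ k}) *
    momR q (∏ k : Fin n, qsign q (initialSet τ k)ᶜ {τ k})⁻¹

end

end DynDet

namespace DynDet

noncomputable section

/-! ### The functions `h` and their shifts -/

/-! The determinant belongs to a family of dynamical minors with row set `I` and column set `J`,
defined by recursive expansion along the rightmost column (`qminor`). Pairing the terms that
exchange two rows in the two rightmost columns writes a minor as a combination of smaller minors
times 2×2 minors (`qminor_cons_cons`). The quadratic relations make a 2×2 minor vanish for equal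
columns and acquire the factor `-h(μ_l - μ_k)` when columns `k < l` are exchanged. After division by
the column sign, minors are therefore independent of the order of the columns. This gives a Laplace
expansion in which cofactors along a wrong column sum to zero: the cofactor matrix times `T_{I,J}`
is diagonal with every diagonal entry equal to the minor (`cofactorMatrix_mul_subMatrix`).

If `T_{I,J}` has an inverse `Y`, multiplying by `Y` on the right gives cofactor = minor · `Y_{ji}`,
hence minor = cofactor · quasideterminant (`map_setMinor_eq_cofactor_mul`). A cofactor is a sign
ratio times a minor with one row and one column fewer, so iterating along `σ` and `τ` down to the
empty minor 1 gives the product formula.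

For existence of the quasideterminants, the minors must be nonzero. Each permutation `π` gives a
representation on meromorphic functions in which `λ_{π(j)}` is identified with `μ_j` and `t_{ij}` is
zero unless `i = π(j)`; a minor with `π(J) = I` then has a single surviving term, which is
invertible (`setMinor_ne_zero`). Laplace gives only a left inverse of `T_{I,J}`. It is also a right
inverse because the rows are left independent over `K`, which follows by induction along the chain
of minors (`RowsIndependent.of_erase`). -/

theorem shift_algebraMap {n : ℕ} (i : Fin n) (f : Entire n) :
    shift i (algebraMap (Entire n) (Mero n) f) =
      algebraMap (Entire n) (Mero n) (translateEquiv (Pi.single i (1 : ℂ)) f) :=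
  IsFractionRing.ringEquivOfRingEquiv_algebraMap _ _

theorem shift_const {n : ℕ} (i : Fin n) (c : ℂ) :
    shift i (algebraMap ℂ (Mero n) c) = algebraMap ℂ (Mero n) c := by
  rw [IsScalarTower.algebraMap_apply ℂ (Entire n) (Mero n), shift_algebraMap]
  rfl

theorem translateEquiv_apply {n : ℕ} (v : Fin n → ℂ) (f : Entire n) (z : Fin n → ℂ) :
    (translateEquiv v f).1 z = f.1 (z + v) := rfl

theorem qexp_apply {n : ℕ} (q : ℂ) (a b : Fin n) (z : Fin n → ℂ) :
    (qexp q a b).1 z = Complex.exp (-2 * (z a - z b) * Complex.log q) := rfl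

theorem const_mul_apply {n : ℕ} (c : ℂ) (f : Entire n) (z : Fin n → ℂ) :
    (algebraMap ℂ (Entire n) c * f).1 z = c * f.1 z := rfl

theorem qexp_translate_of_ne {n : ℕ} (q : ℂ) {a b c : Fin n} (ha : a ≠ c) (hb : b ≠ c) :
    translateEquiv (Pi.single c (1 : ℂ)) (qexp q a b) = qexp q a b := by
  refine Subtype.ext (funext fun z => ?_)
  rw [translateEquiv_apply, qexp_apply, qexp_apply]
  simp [ha, hb]

theorem qexp_translate_left {n : ℕ} {q : ℂ} (hq₀ : q ≠ 0) {a b : Fin n} (hab : a ≠ b) :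
    translateEquiv (Pi.single a (1 : ℂ)) (qexp q a b) =
      algebraMap ℂ (Entire n) (q ^ (-2 : ℤ)) * qexp q a b := by
  refine Subtype.ext (funext fun z => ?_)
  have h1 : (q ^ (-2 : ℤ) : ℂ) = Complex.exp (-2 * Complex.log q) := by
    conv_lhs => rw [← Complex.exp_log hq₀, ← Complex.exp_int_mul]
    norm_num
  rw [translateEquiv_apply, const_mul_apply, qexp_apply, qexp_apply]
  rw [h1, ← Complex.exp_add]
  simp [hab.symm]
  ring_nf

theorem qexp_mul_swap {n : ℕ} (q : ℂ) (a b : Fin n) : qexp q a b * qexp q b a = 1 := by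
  refine Subtype.ext (funext fun z => ?_)
  change Complex.exp (-2 * (z a - z b) * Complex.log q) *
    Complex.exp (-2 * (z b - z a) * Complex.log q) = 1
  rw [← Complex.exp_add, ← Complex.exp_zero]
  ring_nf

theorem qexp_ne_const {n : ℕ} {q : ℂ} (hq : Complex.log q ≠ 0) {a b : Fin n} (hab : a ≠ b)
    (c : ℂ) : algebraMap (Entire n) (Mero n) (qexp q a b) - algebraMap ℂ (Mero n) c ≠ 0 := by
  intro h
  rw [IsScalarTower.algebraMap_apply ℂ (Entire n) (Mero n), sub_eq_zero] at h
  have h1 := IsFractionRing.injective (Entire n) (Mero n) h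
  have h2 : ∀ z : Fin n → ℂ, Complex.exp (-2 * (z a - z b) * Complex.log q) = c :=
    fun z => congrFun (congrArg Subtype.val h1) z
  -- At this point the exponent is `log 2`, so the value is 2, against 1 at the origin.
  have h3 := h2 (Pi.single a (Real.log 2 / (-2 * Complex.log q)))
  have h4 := h2 0
  rw [← h4] at h3
  have h5 : -2 * ((Real.log 2 : ℂ) / (-2 * Complex.log q)) * Complex.log q = Real.log 2 := by
    field_simp
  simp only [Pi.single_eq_same, Pi.single_eq_of_ne hab.symm, sub_zero, h5, Pi.zero_apply,
    mul_zero, zero_mul, Complex.exp_zero] at h3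
  rw [← Complex.ofReal_exp, Real.exp_log two_pos] at h3
  norm_num at h3

theorem log_ne_zero_of_pow_ne_one {q : ℂ} (hq₀ : q ≠ 0) (hq : ∀ m : ℕ, 0 < m → q ^ m ≠ 1) :
    Complex.log q ≠ 0 := by
  intro h
  apply hq 1 one_pos
  rw [pow_one, ← Complex.exp_log hq₀, h, Complex.exp_zero]

theorem hfun_ne_zero {n : ℕ} {q : ℂ} (hq₀ : q ≠ 0) (hl : Complex.log q ≠ 0) {a b : Fin n}
    (hab : a ≠ b) : hfun q a b ≠ 0 := by
  have h1 := qexp_ne_const hl hab (q ^ (-2 : ℤ))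
  have h2 := qexp_ne_const hl hab 1
  rw [map_one] at h2
  exact div_ne_zero (mul_ne_zero ((map_ne_zero _).mpr hq₀) h1) h2

/-! ### The functional equations `h(x) + h(-x) = q + q⁻¹` and `h(x+1) h(-x) = 1`. -/

/-- The fraction `a (x - a⁻²) / (x - 1)` in a field, whose values give the functions `h`. -/
def hval {F : Type*} [Field F] (a x : F) : F := a * (x - a ^ (-2 : ℤ)) / (x - 1)

theorem map_hval {F : Type*} [Field F] (f : F ≃+* F) (a x : F) :
    f (hval a x) = hval (f a) (f x) := by
  simp [hval]

theorem hval_add_hval_inv {F : Type*} [Field F] {a x y : F} (ha : a ≠ 0) (hxy : x * y = 1)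
    (hx : x - 1 ≠ 0) (hy : y - 1 ≠ 0) : hval a x + hval a y = a + a⁻¹ := by
  have h1 : (a ^ (2 : ℤ))⁻¹ * a = a⁻¹ := by field_simp
  rw [hval, hval, div_add_div _ _ hx hy, div_eq_iff (mul_ne_zero hx hy), zpow_neg]
  linear_combination (a - a⁻¹) * hxy + (2 - x - y) * h1

theorem hval_mul_hval_inv {F : Type*} [Field F] {a x y : F} (ha : a ≠ 0) (hxy : x * y = 1)
    (hy : y - 1 ≠ 0) (hx' : x - a ^ 2 ≠ 0) :
    hval a (a ^ (-2 : ℤ) * x) * hval a y = 1 := by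
  have h1 : a ^ 2 * a ^ (-2 : ℤ) = 1 := by
    rw [zpow_neg]
    exact mod_cast mul_inv_cancel₀ (pow_ne_zero 2 ha)
  have h2 : a ^ (-2 : ℤ) * x - 1 ≠ 0 := fun h => hx' (by linear_combination a ^ 2 * h - x * h1)
  rw [hval, hval, div_mul_div_comm, div_eq_one_iff_eq (mul_ne_zero h2 hy)]
  generalize a ^ (-2 : ℤ) = b at *
  linear_combination ((x - 1) * (y - b)) * h1 + (1 - b) * hxy

theorem hfun_eq_hval {n : ℕ} (q : ℂ) (a b : Fin n) :
    hfun q a b =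
      hval (algebraMap ℂ (Mero n) q) (algebraMap (Entire n) (Mero n) (qexp q a b)) := by
  rw [hfun, hval, map_zpow₀]

theorem algebraMap_qexp_mul_swap {n : ℕ} (q : ℂ) (a b : Fin n) :
    algebraMap (Entire n) (Mero n) (qexp q a b) * algebraMap (Entire n) (Mero n) (qexp q b a) =
      1 := by
  rw [← RingHom.map_mul, qexp_mul_swap, RingHom.map_one]

theorem hfun_add_swap {n : ℕ} {q : ℂ} (hq₀ : q ≠ 0) (hl : Complex.log q ≠ 0) {a b : Fin n}
    (hab : a ≠ b) : hfun q a b + hfun q b a = algebraMap ℂ (Mero n) (q + q⁻¹) := by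
  have h2 := qexp_ne_const hl hab 1
  have h3 := qexp_ne_const hl hab.symm 1
  rw [RingHom.map_one] at h2 h3
  rw [RingHom.map_add, map_inv₀, hfun_eq_hval, hfun_eq_hval]
  exact hval_add_hval_inv ((map_ne_zero _).mpr hq₀) (algebraMap_qexp_mul_swap q a b) h2 h3

theorem shift_hfun {n : ℕ} (q : ℂ) (a b c : Fin n) :
    shift c (hfun q a b) = hval (algebraMap ℂ (Mero n) q)
      (algebraMap (Entire n) (Mero n) (translateEquiv (Pi.single c (1 : ℂ)) (qexp q a b))) := by
  rw [hfun_eq_hval, map_hval, shift_const, shift_algebraMap]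

theorem shift_hfun_of_ne {n : ℕ} (q : ℂ) {a b c : Fin n} (ha : a ≠ c) (hb : b ≠ c) :
    shift c (hfun q a b) = hfun q a b := by
  rw [shift_hfun, qexp_translate_of_ne q ha hb, hfun_eq_hval]

theorem shift_hfun_mul_swap {n : ℕ} {q : ℂ} (hq₀ : q ≠ 0) (hl : Complex.log q ≠ 0) {a b : Fin n}
    (hab : a ≠ b) : shift a (hfun q a b) * hfun q b a = 1 := by
  have h3 := qexp_ne_const hl hab.symm 1
  have h4 := qexp_ne_const hl hab (q ^ 2)
  rw [RingHom.map_one] at h3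
  rw [RingHom.map_pow] at h4
  rw [shift_hfun, hfun_eq_hval, qexp_translate_left hq₀ hab, RingHom.map_mul,
    ← IsScalarTower.algebraMap_apply ℂ (Entire n) (Mero n), map_zpow₀]
  exact hval_mul_hval_inv ((map_ne_zero _).mpr hq₀) (algebraMap_qexp_mul_swap q a b) h3 h4

theorem qsign_ne_zero {n : ℕ} {q : ℂ} (hq₀ : q ≠ 0) (hl : Complex.log q ≠ 0)
    (I J : Finset (Fin n)) : qsign q I J ≠ 0 := by
  refine Finset.prod_ne_zero_iff.mpr fun k _ => Finset.prod_ne_zero_iff.mpr fun l hl' => ?_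
  exact neg_ne_zero.mpr (hfun_ne_zero hq₀ hl (Finset.mem_filter.mp hl').2.ne')

theorem qsign_insert {n : ℕ} (q : ℂ) {a : Fin n} {I : Finset (Fin n)} (ha : a ∉ I)
    (J : Finset (Fin n)) : qsign q (insert a I) J = qsign q {a} J * qsign q I J := by
  simp [qsign, Finset.prod_insert ha]

theorem qsign_singleton_of_lt {n : ℕ} (q : ℂ) {a b : Fin n} (h : b < a) :
    qsign q {a} {b} = -hfun q a b := by
  simp [qsign, Finset.filter_singleton, h]

theorem qsign_singleton_of_le {n : ℕ} (q : ℂ) {a b : Fin n} (h : a ≤ b) :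
    qsign q {a} {b} = 1 := by
  simp [qsign, Finset.filter_singleton, h.not_gt]

/-! ### The moment maps and the defining relations -/

section Relations

variable {n : ℕ} (q : ℂ)

theorem momL_const (c : ℂ) : momL q (algebraMap ℂ (Mero n) c) = algebraMap ℂ (DynAlg n q) c :=
  (RingQuot.mkAlgHom_rel ℂ (Rel.lam_scalar c)).trans (AlgHom.commutes _ c)

theorem momR_const (c : ℂ) : momR q (algebraMap ℂ (Mero n) c) = algebraMap ℂ (DynAlg n q) c :=
  (RingQuot.mkAlgHom_rel ℂ (Rel.mu_scalar c)).trans (AlgHom.commutes _ c)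

theorem momL_add (f g : Mero n) : momL q (f + g) = momL q f + momL q g :=
  (RingQuot.mkAlgHom_rel ℂ (Rel.lam_add f g)).trans (map_add _ _ _)

theorem momR_add (f g : Mero n) : momR q (f + g) = momR q f + momR q g :=
  (RingQuot.mkAlgHom_rel ℂ (Rel.mu_add f g)).trans (map_add _ _ _)

theorem momL_mul (f g : Mero n) : momL q (f * g) = momL q f * momL q g :=
  (RingQuot.mkAlgHom_rel ℂ (Rel.lam_mul f g)).trans (map_mul _ _ _)

theorem momR_mul (f g : Mero n) : momR q (f * g) = momR q f * momR q g :=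
  (RingQuot.mkAlgHom_rel ℂ (Rel.mu_mul f g)).trans (map_mul _ _ _)

theorem momL_one : momL q (1 : Mero n) = 1 := by
  rw [← RingHom.map_one (algebraMap ℂ (Mero n)), momL_const, RingHom.map_one]

theorem momR_one : momR q (1 : Mero n) = 1 := by
  rw [← RingHom.map_one (algebraMap ℂ (Mero n)), momR_const, RingHom.map_one]

theorem momL_zero : momL q (0 : Mero n) = 0 := by
  rw [← RingHom.map_zero (algebraMap ℂ (Mero n)), momL_const, RingHom.map_zero]

theorem momR_zero : momR q (0 : Mero n) = 0 := by
  rw [← RingHom.map_zero (algebraMap ℂ (Mero n)), momR_const, RingHom.map_zero]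

/-- The moment map `μ_l` as a ring homomorphism. -/
def momLHom : Mero n →+* DynAlg n q where
  toFun := momL q
  map_one' := momL_one q
  map_mul' := momL_mul q
  map_zero' := momL_zero q
  map_add' := momL_add q

/-- The moment map `μ_r` as a ring homomorphism. -/
def momRHom : Mero n →+* DynAlg n q where
  toFun := momR q
  map_one' := momR_one q
  map_mul' := momR_mul q
  map_zero' := momR_zero q
  map_add' := momR_add q

theorem momL_neg (f : Mero n) : momL q (-f) = -momL q f := by
  refine eq_neg_of_add_eq_zero_left ?_
  rw [← momL_add, neg_add_cancel, momL_zero]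

theorem momR_neg (f : Mero n) : momR q (-f) = -momR q f := by
  refine eq_neg_of_add_eq_zero_left ?_
  rw [← momR_add, neg_add_cancel, momR_zero]

theorem momL_mul_momR (f g : Mero n) : momL q f * momR q g = momR q g * momL q f := by
  have h := RingQuot.mkAlgHom_rel ℂ (Rel.lam_mu (q := q) f g)
  simp only [map_mul] at h
  exact h

theorem momL_mul_t (f : Mero n) (i j : Fin n) :
    momL q f * t q i j = t q i j * momL q (shift i f) := by
  have h := RingQuot.mkAlgHom_rel ℂ (Rel.lam_t (q := q) f i j)
  simp only [map_mul] at h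
  exact h

theorem momR_mul_t (f : Mero n) (i j : Fin n) :
    momR q f * t q i j = t q i j * momR q (shift j f) := by
  have h := RingQuot.mkAlgHom_rel ℂ (Rel.mu_t (q := q) f i j)
  simp only [map_mul] at h
  exact h

theorem momL_hfun_mul_t_mul_t {i j : Fin n} (k : Fin n) (hij : i < j) :
    momL q (hfun q j i) * (t q j k * t q i k) = t q i k * t q j k := by
  have h := RingQuot.mkAlgHom_rel ℂ (Rel.cols (q := q) i j k hij)
  simp only [map_mul] at h
  exact h

theorem t_mul_t_eq_add {i j k l : Fin n} (hij : i < j) (hkl : k < l) :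
    t q i k * t q j l = t q j l * t q i k +
      (momL q (hfun q j i) - momR q (hfun q k l)) * (t q j k * t q i l) := by
  have h := RingQuot.mkAlgHom_rel ℂ (Rel.rtt₁ (q := q) i j k l hij hkl)
  simp only [map_mul, map_add, map_sub] at h
  exact h

theorem t_mul_t_eq_gfun_add {i j k l : Fin n} (hij : i < j) (hkl : k < l) :
    t q i l * t q j k = momR q (gfun q k l) * (t q j k * t q i l) +
      (momR q (hfun q k l) - momL q (hfun q i j)) * (t q j l * t q i k) := by
  have h := RingQuot.mkAlgHom_rel ℂ (Rel.rtt₃ (q := q) i j k l hij hkl)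
  simp only [map_mul, map_add, map_sub] at h
  exact h

end Relations

/-! ### Minors of size two -/

/-- The dynamical minor of rows `i < j` and columns `k`, `l`. -/
def minorTwo {n : ℕ} (q : ℂ) (i j k l : Fin n) : DynAlg n q :=
  t q i k * t q j l - momL q (hfun q j i) * (t q j k * t q i l)

theorem minorTwo_self {n : ℕ} (q : ℂ) {i j : Fin n} (k : Fin n) (hij : i < j) :
    minorTwo q i j k k = 0 := by
  rw [minorTwo, momL_hfun_mul_t_mul_t q k hij, sub_self]

/-- Both sides are the constant `q + q⁻¹`, and the two moment maps agree on constants. This is what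
links `λ` with `μ` in the exchange of columns. -/
theorem momL_hfun_add_swap {n : ℕ} {q : ℂ} (hq₀ : q ≠ 0) (hl : Complex.log q ≠ 0)
    {i j k l : Fin n} (hij : i ≠ j) (hkl : k ≠ l) :
    momL q (hfun q i j) + momL q (hfun q j i) = momR q (hfun q k l) + momR q (hfun q l k) := by
  rw [← momL_add, ← momR_add, hfun_add_swap hq₀ hl hij, hfun_add_swap hq₀ hl hkl, momL_const,
    momR_const]

/-- Used with `a, b = h(±(λ_i - λ_j))`, `c, d = h(±(μ_k - μ_l))`, `x = t_{jk} t_{il}`, `y = t_{jl}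
t_{ik}`; both sides reduce to `d (c x - y)`. -/
theorem sub_mul_eq_neg_mul_sub {A : Type*} [Ring A] {a b c d : A} (h : a + b = c + d) (x y : A) :
    d * c * x + (c - a) * y - b * y = -d * (y + (b - c) * x - b * x) := by
  have h' : c - a - b = -d := by rw [sub_sub, h]; abel
  calc _ = d * (c * x) + (c - a - b) * y := by
        simp only [sub_mul, mul_assoc]; abel
    _ = _ := by
        rw [h']
        simp only [sub_mul, mul_sub, mul_add, neg_mul]; abel

theorem minorTwo_swap {n : ℕ} {q : ℂ} (hq₀ : q ≠ 0) (hl : Complex.log q ≠ 0)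
    {i j k l : Fin n} (hij : i < j) (hkl : k < l) :
    minorTwo q i j l k = momR q (-hfun q l k) * minorTwo q i j k l := by
  have h := momL_hfun_add_swap hq₀ hl hij.ne hkl.ne
  have hg : momR q (hfun q l k) * momR q (hfun q k l) = momR q (gfun q k l) := by
    rw [← momR_mul, gfun, mul_comm]
  rw [minorTwo, minorTwo, t_mul_t_eq_gfun_add q hij hkl, t_mul_t_eq_add q hij hkl, momR_neg,
    ← hg]
  exact sub_mul_eq_neg_mul_sub h _ _

/-! ### Dynamical minors -/

/-- The unnormalised dynamical minor with row set `I` and columns listed in reversed order. -/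
def qminor {n : ℕ} (q : ℂ) : Finset (Fin n) → List (Fin n) → DynAlg n q
  | _, [] => 1
  | I, c :: cs => ∑ k ∈ I, momL q (qsign q (I.erase k) {k}) * qminor q (I.erase k) cs * t q k c

/-- Only entries from rows in `I` occur, and `f` passes each of them unchanged. -/
theorem momL_mul_qminor {n : ℕ} {q : ℂ} {f : Mero n} {I : Finset (Fin n)} (cs : List (Fin n))
    (hf : ∀ k ∈ I, shift k f = f) : momL q f * qminor q I cs = qminor q I cs * momL q f := by
  induction cs generalizing I with
  | nil => simp [qminor]
  | cons c cs ih =>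
    rw [qminor, Finset.mul_sum, Finset.sum_mul]
    refine Finset.sum_congr rfl fun k hk => ?_
    have h1 := ih (I := I.erase k) fun m hm => hf m (Finset.mem_of_mem_erase hm)
    have h2 := momL_mul_t q f k c
    rw [hf k hk] at h2
    rw [mul_assoc _ (t q k c), ← h2, ← mul_assoc _ (momL q f), mul_assoc _ _ (momL q f), ← h1,
      ← mul_assoc, ← mul_assoc, ← mul_assoc, ← momL_mul, ← momL_mul, mul_comm]

theorem momR_mul_qminor {n : ℕ} {q : ℂ} {f : Mero n} (I : Finset (Fin n)) {cs : List (Fin n)}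
    (hf : ∀ c ∈ cs, shift c f = f) : momR q f * qminor q I cs = qminor q I cs * momR q f := by
  induction cs generalizing I with
  | nil => simp [qminor]
  | cons c cs ih =>
    rw [qminor, Finset.mul_sum, Finset.sum_mul]
    refine Finset.sum_congr rfl fun k hk => ?_
    have h1 := ih (I.erase k) fun m hm => hf m (List.mem_cons_of_mem c hm)
    have h2 := momR_mul_t q f k c
    rw [hf c List.mem_cons_self] at h2
    rw [mul_assoc _ (t q k c), ← h2, ← mul_assoc _ (momR q f), mul_assoc _ _ (momR q f), ← h1,
      ← mul_assoc, ← mul_assoc, ← mul_assoc, momL_mul_momR]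

theorem sum_sum_erase {ι A : Type*} [LinearOrder ι] [AddCommMonoid A] (I : Finset ι)
    (F : ι → ι → A) :
    ∑ k ∈ I, ∑ m ∈ I.erase k, F m k = ∑ j ∈ I, ∑ i ∈ I with i < j, (F i j + F j i) := by
  simp_rw [Finset.sum_add_distrib]
  have h : ∑ j ∈ I, ∑ i ∈ I with i < j, F j i = ∑ i ∈ I, ∑ j ∈ I with i < j, F j i :=
    Finset.sum_comm' fun j i => by simp only [Finset.mem_filter]; tauto
  rw [h, ← Finset.sum_add_distrib]
  refine Finset.sum_congr rfl fun k _ => ?_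
  rw [← Finset.sum_union]
  · refine Finset.sum_congr ?_ fun _ _ => rfl
    ext m
    simp only [Finset.mem_erase, Finset.mem_union, Finset.mem_filter, ne_iff_lt_or_gt]
    tauto
  · rw [Finset.disjoint_left]
    intro m hm hm'
    exact lt_asymm (Finset.mem_filter.mp hm).2 (Finset.mem_filter.mp hm').2

theorem qsign_erase {n : ℕ} (q : ℂ) {a b : Fin n} {I : Finset (Fin n)} (ha : a ∈ I) :
    qsign q I {b} = qsign q {a} {b} * qsign q (I.erase a) {b} := by
  rw [← qsign_insert q (Finset.notMem_erase a I), Finset.insert_erase ha]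

theorem mul_add_neg_mul_eq {A : Type*} [Ring A] {u v e D : A} (he : e * D = D * e)
    (huv : u * v = v * u) (hev : e * (u * v) = u * v * e) (x y z w : A) :
    v * (u * D * x) * y + -e * u * (v * D * z) * w = u * v * (D * (x * y - e * (z * w))) := by
  have h1 : v * (u * D * x) * y = u * v * (D * (x * y)) := by rw [huv]; simp only [mul_assoc]
  have h2 : e * u * (v * D * z) * w = u * v * (D * (e * (z * w))) := by
    calc _ = e * (u * v) * (D * (z * w)) := by simp only [mul_assoc]
      _ = u * v * ((e * D) * (z * w)) := by rw [hev]; simp only [mul_assoc]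
      _ = _ := by rw [he]; simp only [mul_assoc]
  rw [mul_sub, mul_sub, ← h1, ← h2]
  simp only [neg_mul, sub_eq_add_neg]

/-- For `i < j` the two ways of placing these rows in the last two columns share the same sign
factors, apart from an extra `-h(λ_j - λ_i)` for the inverted placement. That factor commutes with
the remaining minor, whose rows avoid `i` and `j`, so a 2×2 minor splits off on the right. -/
theorem qminor_cons_cons {n : ℕ} (q : ℂ) (I : Finset (Fin n)) (a b : Fin n) (cs : List (Fin n)) :
    qminor q I (a :: b :: cs) = ∑ j ∈ I, ∑ i ∈ I with i < j,
      momL q (qsign q ((I.erase j).erase i) {i} * qsign q ((I.erase j).erase i) {j}) *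
        (qminor q ((I.erase j).erase i) cs * minorTwo q i j b a) := by
  simp only [qminor, Finset.mul_sum, Finset.sum_mul]
  rw [sum_sum_erase I fun m k => momL q (qsign q (I.erase k) {k}) *
    (momL q (qsign q ((I.erase k).erase m) {m}) * qminor q ((I.erase k).erase m) cs * t q m b) *
      t q k a]
  refine Finset.sum_congr rfl fun j hj => Finset.sum_congr rfl fun i hi => ?_
  obtain ⟨hi, hij⟩ := Finset.mem_filter.mp hi
  rw [Finset.erase_right_comm (a := i), qsign_erase q (Finset.mem_erase.mpr ⟨hij.ne, hi⟩),
    qsign_erase q (Finset.mem_erase.mpr ⟨hij.ne', hj⟩), Finset.erase_right_comm (a := i),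
    qsign_singleton_of_le q hij.le, qsign_singleton_of_lt q hij, one_mul]
  have h : momL q (hfun q j i) * qminor q ((I.erase j).erase i) cs =
      qminor q ((I.erase j).erase i) cs * momL q (hfun q j i) := by
    refine momL_mul_qminor cs fun k hk => shift_hfun_of_ne q ?_ ?_
    · exact (Finset.ne_of_mem_erase (Finset.mem_of_mem_erase hk)).symm
    · exact (Finset.ne_of_mem_erase hk).symm
  generalize qminor q ((I.erase j).erase i) cs = D at *
  generalize qsign q ((I.erase j).erase i) {i} = s
  generalize qsign q ((I.erase j).erase i) {j} = s'
  rw [minorTwo, momL_mul, momL_mul, momL_neg]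
  exact mul_add_neg_mul_eq h (by rw [← momL_mul, ← momL_mul, mul_comm])
    (by rw [← momL_mul, ← momL_mul, ← momL_mul, mul_comm]) _ _ _ _

/-! ### Column antisymmetry -/

theorem qminor_cons_cons_self {n : ℕ} (q : ℂ) (I : Finset (Fin n)) (a : Fin n)
    (cs : List (Fin n)) : qminor q I (a :: a :: cs) = 0 := by
  rw [qminor_cons_cons]
  refine Finset.sum_eq_zero fun j _ => Finset.sum_eq_zero fun i hi => ?_
  rw [minorTwo_self q a (Finset.mem_filter.mp hi).2, mul_zero, mul_zero]

theorem qminor_append_swap {n : ℕ} {q : ℂ} (hq₀ : q ≠ 0) (hl : Complex.log q ≠ 0)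
    (I : Finset (Fin n)) {a b : Fin n} (hab : a < b) (pre : List (Fin n)) {cs : List (Fin n)}
    (ha : a ∉ cs) (hb : b ∉ cs) :
    qminor q I (pre ++ a :: b :: cs) =
      momR q (-hfun q b a) * qminor q I (pre ++ b :: a :: cs) := by
  induction pre generalizing I with
  | nil =>
    rw [List.nil_append, List.nil_append, qminor_cons_cons, qminor_cons_cons, Finset.mul_sum]
    refine Finset.sum_congr rfl fun j _ => ?_
    rw [Finset.mul_sum]
    refine Finset.sum_congr rfl fun i hi => ?_
    have hij := (Finset.mem_filter.mp hi).2
    -- The exchange factor crosses the minor on the columns `cs` because neither `a` nor `b` lies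
    -- there.
    rw [minorTwo_swap hq₀ hl hij hab, ← mul_assoc (qminor q _ cs), ← momR_mul_qminor,
      mul_assoc (momR q _), ← mul_assoc, momL_mul_momR, mul_assoc]
    intro c hc
    rw [RingEquiv.map_neg, shift_hfun_of_ne]
    · rintro rfl; exact hb hc
    · rintro rfl; exact ha hc
  | cons c pre ih =>
    rw [List.cons_append, List.cons_append, qminor, qminor, Finset.mul_sum]
    refine Finset.sum_congr rfl fun k _ => ?_
    rw [ih, ← mul_assoc, momL_mul_momR]
    simp only [mul_assoc]

/-- The sign function of the column sequence listed in reversed order. -/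
def listSign {n : ℕ} (q : ℂ) : List (Fin n) → Mero n
  | [] => 1
  | c :: cs => qsign q cs.toFinset {c} * listSign q cs

theorem listSign_ne_zero {n : ℕ} {q : ℂ} (hq₀ : q ≠ 0) (hl : Complex.log q ≠ 0)
    (cs : List (Fin n)) : listSign q cs ≠ 0 := by
  induction cs with
  | nil => exact one_ne_zero
  | cons c cs ih => exact mul_ne_zero (qsign_ne_zero hq₀ hl _ _) ih

theorem listSign_append_swap {n : ℕ} (q : ℂ) {a b : Fin n} (hab : a < b) (pre : List (Fin n))
    {cs : List (Fin n)} (ha : a ∉ cs) (hb : b ∉ cs) :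
    listSign q (pre ++ a :: b :: cs) = -hfun q b a * listSign q (pre ++ b :: a :: cs) := by
  induction pre with
  | nil =>
    simp only [List.nil_append, listSign, List.toFinset_cons]
    rw [qsign_insert q (by simpa using hb), qsign_insert q (by simpa using ha),
      qsign_singleton_of_le q hab.le, qsign_singleton_of_lt q hab]
    ring
  | cons c pre ih =>
    have h : (pre ++ a :: b :: cs).toFinset = (pre ++ b :: a :: cs).toFinset := by
      ext x; simp only [List.mem_toFinset, List.mem_append, List.mem_cons]; tauto
    simp only [List.cons_append, listSign, h, ih]
    ring

/-- The dynamical minor with row set `I` and columns listed in reversed order. -/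
def nminor {n : ℕ} (q : ℂ) (I : Finset (Fin n)) (cs : List (Fin n)) : DynAlg n q :=
  momR q (listSign q cs)⁻¹ * qminor q I cs

theorem inv_mul_mul_cancel {F : Type*} [Field F] {u : F} (hu : u ≠ 0) (v : F) :
    (u * v)⁻¹ * u = v⁻¹ := by
  rw [mul_inv_rev, mul_assoc, inv_mul_cancel₀ hu, mul_one]

theorem nminor_append_swap_of_lt {n : ℕ} {q : ℂ} (hq₀ : q ≠ 0) (hl : Complex.log q ≠ 0)
    (I : Finset (Fin n)) {a b : Fin n} (hab : a < b) (pre : List (Fin n)) {cs : List (Fin n)}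
    (ha : a ∉ cs) (hb : b ∉ cs) :
    nminor q I (pre ++ a :: b :: cs) = nminor q I (pre ++ b :: a :: cs) := by
  have hu : -hfun q b a ≠ 0 := neg_ne_zero.mpr (hfun_ne_zero hq₀ hl hab.ne')
  rw [nminor, nminor, qminor_append_swap hq₀ hl I hab pre ha hb,
    listSign_append_swap q hab pre ha hb, ← mul_assoc, ← momR_mul,
    inv_mul_mul_cancel hu]

theorem nminor_append_perm {n : ℕ} {q : ℂ} (hq₀ : q ≠ 0) (hl : Complex.log q ≠ 0)
    (I : Finset (Fin n)) {cs cs' : List (Fin n)} (h : cs.Perm cs') (hcs : cs.Nodup) :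
    ∀ pre, nminor q I (pre ++ cs) = nminor q I (pre ++ cs') := by
  induction h with
  | nil => exact fun _ => rfl
  | cons c _ ih =>
    intro pre
    -- The statement is quantified over prefixes so that the common head can be absorbed into the
    -- prefix.
    simpa using ih (List.nodup_cons.mp hcs).2 (pre ++ [c])
  | swap x y l =>
    intro pre
    obtain ⟨hy, hx⟩ := List.nodup_cons.mp hcs
    rw [List.mem_cons, not_or] at hy
    rcases lt_or_gt_of_ne hy.1 with hlt | hlt
    · exact nminor_append_swap_of_lt hq₀ hl I hlt pre hy.2 (List.nodup_cons.mp hx).1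
    · exact (nminor_append_swap_of_lt hq₀ hl I hlt pre (List.nodup_cons.mp hx).1 hy.2).symm
  | trans h₁ _ ih₁ ih₂ => exact fun pre => (ih₁ hcs pre).trans (ih₂ (h₁.nodup_iff.mp hcs) pre)

theorem nminor_perm {n : ℕ} {q : ℂ} (hq₀ : q ≠ 0) (hl : Complex.log q ≠ 0)
    (I : Finset (Fin n)) {cs cs' : List (Fin n)} (h : cs.Perm cs') (hcs : cs.Nodup) :
    nminor q I cs = nminor q I cs' :=
  nminor_append_perm hq₀ hl I h hcs []

theorem nminor_cons {n : ℕ} (q : ℂ) (I : Finset (Fin n)) (c : Fin n) (cs : List (Fin n)) :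
    nminor q I (c :: cs) = ∑ k ∈ I, momR q (qsign q cs.toFinset {c})⁻¹ *
      momL q (qsign q (I.erase k) {k}) * nminor q (I.erase k) cs * t q k c := by
  rw [nminor, qminor, Finset.mul_sum]
  refine Finset.sum_congr rfl fun k _ => ?_
  rw [nminor, listSign, mul_inv, momR_mul]
  simp only [mul_assoc]
  rw [← mul_assoc (momL q _) (momR q _), momL_mul_momR, mul_assoc]

theorem sum_nminor_mul_t_of_mem {n : ℕ} (q : ℂ) (I : Finset (Fin n)) {l : Fin n}
    {cs : List (Fin n)} (hl' : cs.head? = some l) :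
    ∑ k ∈ I, momL q (qsign q (I.erase k) {k}) * nminor q (I.erase k) cs * t q k l = 0 := by
  obtain ⟨cs, rfl⟩ := List.head?_eq_some_iff.mp hl'
  have h := qminor_cons_cons_self q I l cs
  rw [qminor] at h
  rw [← mul_zero (momR q (listSign q (l :: cs))⁻¹), ← h, Finset.mul_sum]
  refine Finset.sum_congr rfl fun k _ => ?_
  rw [nminor]
  simp only [← mul_assoc]
  rw [momL_mul_momR]

/-! ### Minors indexed by column sets and their Laplace expansion -/

/-- The dynamical minor with row set `I` and column set `J`. -/
def setMinor {n : ℕ} (q : ℂ) (I J : Finset (Fin n)) : DynAlg n q := nminor q I J.toList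

/-- Order independence makes the arbitrary enumeration `Finset.toList` harmless; any convenient
order may be substituted. -/
theorem setMinor_eq_nminor {n : ℕ} {q : ℂ} (hq₀ : q ≠ 0) (hl : Complex.log q ≠ 0)
    (I : Finset (Fin n)) {cs : List (Fin n)} (hcs : cs.Nodup) :
    setMinor q I cs.toFinset = nminor q I cs :=
  nminor_perm hq₀ hl I (List.toFinset_toList hcs) (Finset.nodup_toList _)

/-- The cofactor of the entry in row `i` and column `j` of the minor with row set `I` and column
set `J`. -/
def cofactor {n : ℕ} (q : ℂ) (I J : Finset (Fin n)) (j i : Fin n) : DynAlg n q :=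
  momR q (qsign q (J.erase j) {j})⁻¹ * momL q (qsign q (I.erase i) {i}) *
    setMinor q (I.erase i) (J.erase j)

theorem sum_cofactor_mul_t_self {n : ℕ} {q : ℂ} (hq₀ : q ≠ 0) (hl : Complex.log q ≠ 0)
    (I : Finset (Fin n)) {J : Finset (Fin n)} {j : Fin n} (hj : j ∈ J) :
    ∑ i ∈ I, cofactor q I J j i * t q i j = setMinor q I J := by
  have h1 : (j :: (J.erase j).toList).Nodup :=
    List.nodup_cons.mpr ⟨by simp, Finset.nodup_toList _⟩
  have h2 : (j :: (J.erase j).toList).toFinset = J := by simp [hj]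
  conv_rhs => rw [← h2, setMinor_eq_nminor hq₀ hl I h1, nminor_cons, Finset.toList_toFinset]
  rfl

/-- The sum expands, up to a column sign, a minor in which column `j` is replaced by `l`. Listing
the other occurrence of `l` next to it gives two equal adjacent columns, hence zero. -/
theorem sum_cofactor_mul_t_of_ne {n : ℕ} {q : ℂ} (hq₀ : q ≠ 0) (hl : Complex.log q ≠ 0)
    (I : Finset (Fin n)) {J : Finset (Fin n)} {j l : Fin n} (hlJ : l ∈ J)
    (hjl : j ≠ l) : ∑ i ∈ I, cofactor q I J j i * t q i l = 0 := by
  have hlj : l ∈ J.erase j := Finset.mem_erase.mpr ⟨hjl.symm, hlJ⟩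
  have h1 : (l :: ((J.erase j).erase l).toList).Nodup :=
    List.nodup_cons.mpr ⟨by simp, Finset.nodup_toList _⟩
  have h2 : (l :: ((J.erase j).erase l).toList).toFinset = J.erase j := by
    rw [List.toFinset_cons, Finset.toList_toFinset, Finset.insert_erase hlj]
  have h3 := sum_nminor_mul_t_of_mem q I (l := l) (cs := l :: ((J.erase j).erase l).toList) rfl
  rw [← mul_zero (momR q (qsign q (J.erase j) {j})⁻¹), ← h3, Finset.mul_sum]
  refine Finset.sum_congr rfl fun i _ => ?_
  rw [cofactor, ← setMinor_eq_nminor hq₀ hl _ h1, h2]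
  simp only [mul_assoc]

/-! ### The determinant as a minor -/

/-- The generalized sign function of a sequence. -/
def seqSign {n m : ℕ} (q : ℂ) (f : Fin m → Fin n) : Mero n :=
  ∏ k : Fin m, ∏ l : Fin m with k < l ∧ f l < f k, -hfun q (f k) (f l)

theorem seqSign_snoc {n m : ℕ} (q : ℂ) {f : Fin m → Fin n} (hf : f.Injective) (c : Fin n) :
    seqSign q (Fin.snoc f c : Fin (m + 1) → Fin n) =
      qsign q (Finset.univ.image f) {c} * seqSign q f := by
  have h1 : qsign q (Finset.univ.image f) {c} =
      ∏ k : Fin m, if c < f k then -hfun q (f k) c else 1 := by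
    rw [qsign, Finset.prod_image hf.injOn]
    refine Finset.prod_congr rfl fun k _ => ?_
    rw [Finset.prod_filter, Finset.prod_singleton]
  rw [h1]
  simp only [seqSign, Finset.prod_filter]
  rw [Fin.prod_univ_castSucc, ← Finset.prod_mul_distrib]
  simp only [Fin.prod_univ_castSucc (n := m), Fin.snoc_castSucc, Fin.snoc_last, lt_irrefl,
    Fin.castSucc_lt_castSucc_iff, Fin.castSucc_lt_last, true_and, false_and, if_false,
    (Fin.castSucc_lt_last _).not_gt, Finset.prod_const_one, mul_one]
  exact Finset.prod_congr rfl fun k _ => mul_comm _ _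

theorem listSign_reverse_ofFn {n m : ℕ} (q : ℂ) {f : Fin m → Fin n} (hf : f.Injective) :
    listSign q (List.ofFn f).reverse = seqSign q f := by
  induction m with
  | zero => simp [listSign, seqSign]
  | succ m ih =>
    have hf' : (Fin.init f).Injective := hf.comp (Fin.castSucc_injective m)
    conv_rhs => rw [← Fin.snoc_init_self f, seqSign_snoc q hf']
    rw [List.ofFn_succ', List.concat_eq_append, List.reverse_append, List.reverse_singleton,
      List.singleton_append, listSign]
    congr 1
    · congr 1
      ext x
      simp [Fin.init]
    · exact ih hf'

theorem image_snoc_eq_iff {n m : ℕ} {I : Finset (Fin n)} (hI : I.card = m + 1)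
    (f : Fin m → Fin n) (k : Fin n) :
    Finset.univ.image (Fin.snoc f k : Fin (m + 1) → Fin n) = I ↔
      k ∈ I ∧ Finset.univ.image f = I.erase k := by
  have h : Finset.univ.image (Fin.snoc f k : Fin (m + 1) → Fin n) =
      insert k (Finset.univ.image f) := by
    ext x
    simp only [Finset.mem_image, Finset.mem_univ, true_and, Finset.mem_insert]
    rw [Fin.exists_fin_succ']
    simp only [Fin.snoc_castSucc, Fin.snoc_last]
    rw [or_comm, eq_comm]
  rw [h]
  constructor
  · rintro rfl
    refine ⟨Finset.mem_insert_self _ _, (Finset.eq_of_subset_of_card_le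
      (fun x hx => ?_) ?_).symm⟩
    · obtain ⟨h1, h2⟩ := Finset.mem_erase.mp hx
      exact (Finset.mem_insert.mp h2).resolve_left h1
    · rw [Finset.card_erase_of_mem (Finset.mem_insert_self _ _), hI, Nat.add_sub_cancel]
      exact Finset.card_image_le.trans (by simp)
  · rintro ⟨hk, hf⟩
    rw [hf, Finset.insert_erase hk]

theorem injective_of_image_card {n m : ℕ} {I : Finset (Fin n)} (hI : I.card = m)
    {f : Fin m → Fin n} (hf : Finset.univ.image f = I) : f.Injective := by
  have h : Set.InjOn f (Finset.univ : Finset (Fin m)) :=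
    Finset.card_image_iff.mp (by rw [hf, hI, Finset.card_univ, Fintype.card_fin])
  rwa [Finset.coe_univ, Set.injOn_univ] at h

/-- By cardinality the maps with image `I` are the bijections onto `I`; `Fin.snoc` matches the
choice of a row for the last column with the recursion. -/
theorem qminor_reverse_ofFn {n m : ℕ} (q : ℂ) {I : Finset (Fin n)} (hI : I.card = m)
    (c : Fin m → Fin n) :
    qminor q I (List.ofFn c).reverse = ∑ f : Fin m → Fin n with Finset.univ.image f = I,
      momL q (seqSign q f) * (List.ofFn fun k => t q (f k) (c k)).prod := by
  induction m generalizing I with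
  | zero =>
    rw [Finset.card_eq_zero.mp hI]
    simp [qminor, seqSign, momL_one]
  | succ m ih =>
    rw [List.ofFn_succ', List.concat_eq_append, List.reverse_append, List.reverse_singleton,
      List.singleton_append, qminor, Finset.sum_filter,
      ← (Fin.snocEquiv fun _ : Fin (m + 1) => Fin n).sum_comp, Fintype.sum_prod_type,
      ← Finset.sum_subset (Finset.subset_univ I)]
    · refine Finset.sum_congr rfl fun k hk => ?_
      have hI' : (I.erase k).card = m := by rw [Finset.card_erase_of_mem hk, hI, Nat.add_sub_cancel]
      rw [ih hI', Finset.mul_sum, Finset.sum_mul, Finset.sum_filter]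
      refine Finset.sum_congr rfl fun f _ => ?_
      have hs : (Fin.snocEquiv fun _ : Fin (m + 1) => Fin n) (k, f) =
          (Fin.snoc f k : Fin (m + 1) → Fin n) := rfl
      rw [hs]
      have := image_snoc_eq_iff hI f k
      by_cases hf : Finset.univ.image f = I.erase k
      · rw [if_pos hf, if_pos (this.mpr ⟨hk, hf⟩),
          seqSign_snoc q (injective_of_image_card hI' hf), hf, momL_mul, List.ofFn_succ',
          List.concat_eq_append, List.prod_append]
        simp only [Fin.snoc_castSucc, Fin.snoc_last, List.prod_singleton, mul_assoc]
      · rw [if_neg hf, if_neg fun h => hf (this.mp h).2]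
    · intro k _ hk
      refine Finset.sum_eq_zero fun f _ => if_neg fun h => hk ?_
      exact ((image_snoc_eq_iff hI f k).mp h).1

theorem dynDet_eq_setMinor {n : ℕ} {q : ℂ} (hq₀ : q ≠ 0) (hl : Complex.log q ≠ 0)
    (ρ : Equiv.Perm (Fin n)) : dynDet q ρ = setMinor q Finset.univ Finset.univ := by
  have h1 : (List.ofFn ρ).reverse.Nodup :=
    List.nodup_reverse.mpr (List.nodup_ofFn.mpr ρ.injective)
  have h2 : (List.ofFn ρ).reverse.toFinset = Finset.univ := by
    ext x; simpa using ρ.surjective x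
  rw [← h2, setMinor_eq_nminor hq₀ hl _ h1, nminor, listSign_reverse_ofFn q ρ.injective,
    qminor_reverse_ofFn q (by simp [h2]), dynDet]
  congr 1
  refine Finset.sum_bij (fun σ _ => ⇑σ) (fun σ _ => ?_) (fun _ _ _ _ h => DFunLike.coe_injective h)
    (fun f hf => ?_) fun _ _ => rfl
  · rw [h2]; simp [Finset.image_univ_equiv]
  · have h3 : f.Surjective := fun x => by
      have : x ∈ Finset.univ.image f := by
        rw [(Finset.mem_filter.mp hf).2, h2]; exact Finset.mem_univ x
      simpa using this
    exact ⟨Equiv.ofBijective f (Finite.injective_iff_bijective.mp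
      (Finite.injective_iff_surjective.mpr h3)), Finset.mem_univ _, rfl⟩

/-! ### A representation on meromorphic functions for each permutation -/

/-- Permutation of the variables as an automorphism of the ring of entire functions. -/
def permEntire {n : ℕ} (π : Equiv.Perm (Fin n)) : Entire n ≃+* Entire n where
  toFun f := ⟨fun z => f.1 (fun i => z (π.symm i)), fun z _ =>
    AnalyticAt.fun_comp (f := fun (z : Fin n → ℂ) (i : Fin n) => z (π.symm i)) (f.2 _ (Set.mem_univ _))
      ((ContinuousLinearMap.pi fun i => ContinuousLinearMap.proj (R := ℂ)
        (φ := fun _ : Fin n => ℂ) (π.symm i)).analyticAt z)⟩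
  invFun f := ⟨fun z => f.1 (fun i => z (π i)), fun z _ =>
    AnalyticAt.fun_comp (f := fun (z : Fin n → ℂ) (i : Fin n) => z (π i)) (f.2 _ (Set.mem_univ _))
      ((ContinuousLinearMap.pi fun i => ContinuousLinearMap.proj (R := ℂ)
        (φ := fun _ : Fin n => ℂ) (π i)).analyticAt z)⟩
  left_inv f := Subtype.ext (funext fun z => congrArg f.1 (by simp))
  right_inv f := Subtype.ext (funext fun z => congrArg f.1 (by simp))
  map_mul' _ _ := rfl
  map_add' _ _ := rfl

theorem permEntire_apply {n : ℕ} (π : Equiv.Perm (Fin n)) (f : Entire n) (z : Fin n → ℂ) :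
    (permEntire π f).1 z = f.1 (fun i => z (π.symm i)) := rfl

/-- Permutation of the variables as an automorphism of the field of meromorphic functions. -/
def permMero {n : ℕ} (π : Equiv.Perm (Fin n)) : Mero n ≃+* Mero n :=
  IsFractionRing.ringEquivOfRingEquiv (permEntire π)

theorem permMero_algebraMap {n : ℕ} (π : Equiv.Perm (Fin n)) (f : Entire n) :
    permMero π (algebraMap (Entire n) (Mero n) f) =
      algebraMap (Entire n) (Mero n) (permEntire π f) :=
  IsFractionRing.ringEquivOfRingEquiv_algebraMap _ _

theorem permMero_const {n : ℕ} (π : Equiv.Perm (Fin n)) (c : ℂ) :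
    permMero π (algebraMap ℂ (Mero n) c) = algebraMap ℂ (Mero n) c := by
  rw [IsScalarTower.algebraMap_apply ℂ (Entire n) (Mero n), permMero_algebraMap]
  rfl

/-- With `λ_{π(j)}` set equal to `μ_j`, coefficients such as `h(λ_j - λ_i) - h(μ_k - μ_l)` become
zero for `j = π(k)`, `i = π(l)`. -/
theorem permMero_hfun {n : ℕ} (π : Equiv.Perm (Fin n)) (q : ℂ) (a b : Fin n) :
    permMero π (hfun q (π a) (π b)) = hfun q a b := by
  have h : permEntire π (qexp q (π a) (π b)) = qexp q a b := by
    refine Subtype.ext (funext fun z => ?_)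
    rw [permEntire_apply, qexp_apply, qexp_apply, Equiv.symm_apply_apply, Equiv.symm_apply_apply]
  rw [hfun_eq_hval, map_hval, permMero_const, permMero_algebraMap, h, hfun_eq_hval]

theorem mero_hom_ext {n : ℕ} {f g : Mero n →+* Mero n}
    (h : ∀ x, f (algebraMap (Entire n) (Mero n) x) = g (algebraMap (Entire n) (Mero n) x))
    (x : Mero n) : f x = g x :=
  RingHom.congr_fun (IsLocalization.ringHom_ext (nonZeroDivisors (Entire n))
    (RingHom.ext h)) x

theorem permMero_shift {n : ℕ} (π : Equiv.Perm (Fin n)) (j : Fin n) (f : Mero n) :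
    permMero π (shift (π j) f) = shift j (permMero π f) := by
  refine mero_hom_ext (f := (permMero π : Mero n →+* Mero n).comp (shift (π j) : Mero n →+* Mero n))
    (g := (shift j : Mero n →+* Mero n).comp (permMero π : Mero n →+* Mero n)) (fun x => ?_) f
  change permMero π (shift (π j) _) = shift j (permMero π _)
  rw [shift_algebraMap, permMero_algebraMap, permMero_algebraMap, shift_algebraMap]
  congr 1
  refine Subtype.ext (funext fun z => ?_)
  rw [permEntire_apply, translateEquiv_apply, translateEquiv_apply, permEntire_apply]
  refine congrArg x.1 (funext fun i => ?_)
  simp only [Pi.add_apply, Pi.single_apply, Equiv.symm_apply_eq]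

theorem shift_comm {n : ℕ} (i j : Fin n) (f : Mero n) :
    shift i (shift j f) = shift j (shift i f) := by
  refine mero_hom_ext (f := (shift i : Mero n →+* Mero n).comp (shift j : Mero n →+* Mero n))
    (g := (shift j : Mero n →+* Mero n).comp (shift i : Mero n →+* Mero n)) (fun x => ?_) f
  change shift i (shift j _) = shift j (shift i _)
  rw [shift_algebraMap, shift_algebraMap, shift_algebraMap, shift_algebraMap]
  congr 1
  refine Subtype.ext (funext fun z => ?_)
  simp only [translateEquiv_apply]
  rw [add_right_comm]

/-- The inverse of the `i`-th shift as an algebra homomorphism. -/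
def unshift {n : ℕ} (i : Fin n) : Mero n →ₐ[ℂ] Mero n where
  toRingHom := ((shift i).symm : Mero n →+* Mero n)
  commutes' c := (RingEquiv.symm_apply_eq _).mpr (shift_const i c).symm

theorem unshift_shift {n : ℕ} (i : Fin n) (f : Mero n) : unshift i (shift i f) = f :=
  (shift i).symm_apply_apply f

theorem shift_unshift {n : ℕ} (i : Fin n) (f : Mero n) : shift i (unshift i f) = f :=
  (shift i).apply_symm_apply f

theorem unshift_of_shift {n : ℕ} {i : Fin n} {f : Mero n} (h : shift i f = f) :
    unshift i f = f := by
  conv_lhs => rw [← h]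
  exact unshift_shift i f

theorem unshift_comm {n : ℕ} (i j : Fin n) (f : Mero n) :
    unshift i (unshift j f) = unshift j (unshift i f) := by
  apply (shift i).injective
  apply (shift j).injective
  rw [shift_unshift, shift_unshift, shift_comm, shift_unshift, shift_unshift]

/-- The cocycle by which the shifts are twisted. -/
def cocycle {n : ℕ} (q : ℂ) (π : Equiv.Perm (Fin n)) (l : Fin n) : Mero n :=
  ∏ k : Fin n with k < l ∧ π l < π k, hfun q l k

theorem cocycle_ne_zero {n : ℕ} {q : ℂ} (hq₀ : q ≠ 0) (hl : Complex.log q ≠ 0)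
    (π : Equiv.Perm (Fin n)) (l : Fin n) : cocycle q π l ≠ 0 :=
  Finset.prod_ne_zero_iff.mpr fun _ hk =>
    hfun_ne_zero hq₀ hl (Finset.mem_filter.mp hk).2.1.ne'

theorem unshift_prod_hfun {n : ℕ} (q : ℂ) {k l : Fin n} (hkl : l ≠ k) {I : Finset (Fin n)}
    (hI : k ∉ I) : unshift k (∏ m ∈ I, hfun q l m) = ∏ m ∈ I, hfun q l m := by
  rw [map_prod]
  refine Finset.prod_congr rfl fun m hm => unshift_of_shift (shift_hfun_of_ne q hkl ?_)
  rintro rfl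
  exact hI hm

/-- Only the factor `h(λ_l - λ_k)` moves under the `k`-th shift, and `h(λ_k - λ_l) h(λ_l - λ_k + 1)
= 1`. The cocycle is chosen so that the twisted shifts commute up to `g` exactly at the inversions
of `π`, as the relations demand. -/
theorem cocycle_eq_mul_unshift {n : ℕ} {q : ℂ} (hq₀ : q ≠ 0) (hl : Complex.log q ≠ 0)
    {π : Equiv.Perm (Fin n)} {k l : Fin n} (hkl : k < l) (hπ : π l < π k) :
    cocycle q π l = gfun q k l * unshift k (cocycle q π l) := by
  have h1 : hfun q k l * unshift k (hfun q l k) = 1 := by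
    have h := congrArg (unshift k) (shift_hfun_mul_swap hq₀ hl hkl.ne)
    rwa [map_mul, unshift_shift, map_one] at h
  have h2 : k ∈ Finset.univ.filter fun k => k < l ∧ π l < π k :=
    Finset.mem_filter.mpr ⟨Finset.mem_univ k, hkl, hπ⟩
  have h3 : unshift k (cocycle q π l) = unshift k (hfun q l k) *
      ∏ m ∈ (Finset.univ.filter fun k => k < l ∧ π l < π k).erase k, hfun q l m := by
    rw [cocycle, ← Finset.mul_prod_erase _ _ h2, map_mul,
      unshift_prod_hfun q hkl.ne' (Finset.notMem_erase k _)]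
  rw [h3, gfun, cocycle, ← Finset.mul_prod_erase _ _ h2]
  linear_combination -(hfun q l k * ∏ m ∈ (Finset.univ.filter fun k => k < l ∧ π l < π k).erase k,
    hfun q l m) * h1

/-- The operator `f ↦ c · f(λ - e_j)` on meromorphic functions, `c` being the cocycle. -/
def shiftOp {n : ℕ} (q : ℂ) (π : Equiv.Perm (Fin n)) (j : Fin n) : Module.End ℂ (Mero n) :=
  Algebra.lmul ℂ (Mero n) (cocycle q π j) * (unshift j).toLinearMap

theorem shiftOp_apply {n : ℕ} (q : ℂ) (π : Equiv.Perm (Fin n)) (j : Fin n) (f : Mero n) :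
    shiftOp q π j f = cocycle q π j * unshift j f := rfl

theorem shiftOp_mul_apply {n : ℕ} (q : ℂ) (π : Equiv.Perm (Fin n)) (j k : Fin n) (f : Mero n) :
    (shiftOp q π j * shiftOp q π k) f =
      cocycle q π j * unshift j (cocycle q π k) * unshift j (unshift k f) := by
  rw [Module.End.mul_apply, shiftOp_apply, shiftOp_apply, map_mul, mul_assoc]

theorem shiftOp_mul_comm {n : ℕ} (q : ℂ) {π : Equiv.Perm (Fin n)} {k l : Fin n} (hkl : k < l)
    (hπ : π k < π l) : shiftOp q π k * shiftOp q π l = shiftOp q π l * shiftOp q π k := by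
  refine LinearMap.ext fun f => ?_
  rw [shiftOp_mul_apply, shiftOp_mul_apply, unshift_comm k l, cocycle, cocycle,
    unshift_prod_hfun q hkl.ne' (by simp [hπ.le]), unshift_prod_hfun q hkl.ne (by simp [hkl.le])]
  rw [mul_comm (∏ _ ∈ _, _)]

theorem shiftOp_mul_swap {n : ℕ} {q : ℂ} (hq₀ : q ≠ 0) (hl : Complex.log q ≠ 0)
    {π : Equiv.Perm (Fin n)} {k l : Fin n} (hkl : k < l) (hπ : π l < π k) :
    shiftOp q π l * shiftOp q π k =
      Algebra.lmul ℂ (Mero n) (gfun q k l) * (shiftOp q π k * shiftOp q π l) := by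
  refine LinearMap.ext fun f => ?_
  have h : unshift l (cocycle q π k) = cocycle q π k :=
    unshift_prod_hfun q hkl.ne (by simp [hkl.le])
  change _ = gfun q k l * (shiftOp q π k * shiftOp q π l) f
  rw [shiftOp_mul_apply, shiftOp_mul_apply, unshift_comm k l, h]
  conv_lhs => rw [cocycle_eq_mul_unshift hq₀ hl hkl hπ]
  ring

theorem lmul_mul_shiftOp {n : ℕ} (q : ℂ) (π : Equiv.Perm (Fin n)) (j : Fin n) (f : Mero n) :
    Algebra.lmul ℂ (Mero n) f * shiftOp q π j =
      shiftOp q π j * Algebra.lmul ℂ (Mero n) (shift j f) := by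
  refine LinearMap.ext fun g => ?_
  change f * (cocycle q π j * unshift j g) = cocycle q π j * unshift j (shift j f * g)
  rw [map_mul, unshift_shift, mul_left_comm]

theorem isUnit_shiftOp {n : ℕ} {q : ℂ} (hq₀ : q ≠ 0) (hl : Complex.log q ≠ 0)
    (π : Equiv.Perm (Fin n)) (j : Fin n) : IsUnit (shiftOp q π j) := by
  refine ((cocycle_ne_zero hq₀ hl π j).isUnit.map (Algebra.lmul ℂ (Mero n))).mul ?_
  exact (Module.End.isUnit_iff _).mpr (shift j).symm.bijective

/-! ### The operators attached to `π` and the defining relations. -/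

/-- The images of the generators `t_{ij}`. -/
def tOp {n : ℕ} (q : ℂ) (π : Equiv.Perm (Fin n)) (i j : Fin n) : Module.End ℂ (Mero n) :=
  if i = π j then shiftOp q π j else 0

/-- The images of the generators. -/
def genOp {n : ℕ} (q : ℂ) (π : Equiv.Perm (Fin n)) : Gen n → Module.End ℂ (Mero n)
  | .t i j => tOp q π i j
  | .lam f => Algebra.lmul ℂ (Mero n) (permMero π f)
  | .mu f => Algebra.lmul ℂ (Mero n) f

theorem tOp_of_ne {n : ℕ} (q : ℂ) {π : Equiv.Perm (Fin n)} {i j : Fin n} (h : i ≠ π j) :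
    tOp q π i j = 0 := if_neg h

theorem tOp_self {n : ℕ} (q : ℂ) (π : Equiv.Perm (Fin n)) (j : Fin n) :
    tOp q π (π j) j = shiftOp q π j := if_pos rfl

theorem tOp_mul_tOp_of_not {n : ℕ} (q : ℂ) {π : Equiv.Perm (Fin n)} {i j k l : Fin n}
    (h : ¬(i = π k ∧ j = π l)) : tOp q π i k * tOp q π j l = 0 := by
  rw [not_and_or] at h
  rcases h with h | h
  · rw [tOp_of_ne q h, zero_mul]
  · rw [tOp_of_ne q h, mul_zero]

theorem eq_and_eq_cases {α : Type*} (i j k l : α) :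
    (i = k ∧ j = l) ∨ (i = l ∧ j = k) ∨ (¬(i = k ∧ j = l) ∧ ¬(i = l ∧ j = k)) := by
  tauto

theorem permMero_gfun {n : ℕ} (π : Equiv.Perm (Fin n)) (q : ℂ) (a b : Fin n) :
    permMero π (gfun q (π a) (π b)) = gfun q a b := by
  rw [gfun, map_mul, permMero_hfun, permMero_hfun, gfun]

/-- If `(i, j) = (π k, π l)`, the relation says that the two twisted shifts commute, there being no
inversion. If `(i, j) = (π l, π k)`, the coefficient of the only surviving product vanishes.
Otherwise every product is zero. The other three relations split in the same way. -/
theorem genOp_rtt₁ {n : ℕ} (q : ℂ) (π : Equiv.Perm (Fin n)) {i j k l : Fin n} (hij : i < j)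
    (hkl : k < l) :
    tOp q π i k * tOp q π j l = tOp q π j l * tOp q π i k +
      (Algebra.lmul ℂ (Mero n) (permMero π (hfun q j i)) - Algebra.lmul ℂ (Mero n) (hfun q k l)) *
        (tOp q π j k * tOp q π i l) := by
  rcases eq_and_eq_cases i j (π k) (π l) with ⟨rfl, rfl⟩ | ⟨rfl, rfl⟩ | ⟨h, h'⟩
  · rw [tOp_mul_tOp_of_not q (i := π l) fun h' => hij.ne' h'.1, mul_zero, add_zero, tOp_self,
      tOp_self, shiftOp_mul_comm q hkl hij]
  · rw [permMero_hfun, sub_self, zero_mul, add_zero,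
      tOp_mul_tOp_of_not q fun h' => hij.ne h'.1, tOp_mul_tOp_of_not q fun h' => hij.ne h'.2]
  · rw [tOp_mul_tOp_of_not q h, tOp_mul_tOp_of_not q fun h'' => h h''.symm,
      tOp_mul_tOp_of_not q fun h'' => h' h''.symm, mul_zero, add_zero]

theorem genOp_rtt₂ {n : ℕ} (q : ℂ) (π : Equiv.Perm (Fin n)) {i j k l : Fin n} (hij : i < j)
    (hkl : k < l) :
    Algebra.lmul ℂ (Mero n) (gfun q k l) * (tOp q π i k * tOp q π j l) =
      Algebra.lmul ℂ (Mero n) (permMero π (gfun q i j)) * (tOp q π j l * tOp q π i k) +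
      (Algebra.lmul ℂ (Mero n) (hfun q l k) - Algebra.lmul ℂ (Mero n) (permMero π (hfun q i j))) *
        (tOp q π i l * tOp q π j k) := by
  rcases eq_and_eq_cases i j (π k) (π l) with ⟨rfl, rfl⟩ | ⟨rfl, rfl⟩ | ⟨h, h'⟩
  · rw [tOp_mul_tOp_of_not q (i := π k) fun h' => hij.ne h'.1, mul_zero, add_zero, tOp_self,
      tOp_self, shiftOp_mul_comm q hkl hij, permMero_gfun]
  · rw [permMero_hfun, sub_self, zero_mul, add_zero,
      tOp_mul_tOp_of_not q fun h' => hij.ne h'.1, tOp_mul_tOp_of_not q fun h' => hij.ne h'.2,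
      mul_zero, mul_zero]
  · rw [tOp_mul_tOp_of_not q h, tOp_mul_tOp_of_not q fun h'' => h h''.symm,
      tOp_mul_tOp_of_not q h', mul_zero, mul_zero, mul_zero, add_zero]

theorem genOp_rtt₃ {n : ℕ} {q : ℂ} (hq₀ : q ≠ 0) (hl : Complex.log q ≠ 0)
    (π : Equiv.Perm (Fin n)) {i j k l : Fin n} (hij : i < j) (hkl : k < l) :
    tOp q π i l * tOp q π j k =
      Algebra.lmul ℂ (Mero n) (gfun q k l) * (tOp q π j k * tOp q π i l) +
      (Algebra.lmul ℂ (Mero n) (hfun q k l) - Algebra.lmul ℂ (Mero n) (permMero π (hfun q i j))) *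
        (tOp q π j l * tOp q π i k) := by
  rcases eq_and_eq_cases i j (π k) (π l) with ⟨rfl, rfl⟩ | ⟨rfl, rfl⟩ | ⟨h, h'⟩
  · rw [permMero_hfun, sub_self, zero_mul, add_zero,
      tOp_mul_tOp_of_not q fun h' => hij.ne h'.1, tOp_mul_tOp_of_not q fun h' => hij.ne h'.2, mul_zero]
  · rw [tOp_mul_tOp_of_not q (j := π l) fun h' => hij.ne h'.2, mul_zero, add_zero, tOp_self,
      tOp_self, shiftOp_mul_swap hq₀ hl hkl hij]
  · rw [tOp_mul_tOp_of_not q h', tOp_mul_tOp_of_not q fun h'' => h' h''.symm,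
      tOp_mul_tOp_of_not q fun h'' => h h''.symm, mul_zero, mul_zero, add_zero]

theorem gfun_comm {n : ℕ} (q : ℂ) (a b : Fin n) : gfun q a b = gfun q b a := mul_comm _ _

theorem genOp_rtt₄ {n : ℕ} {q : ℂ} (hq₀ : q ≠ 0) (hl : Complex.log q ≠ 0)
    (π : Equiv.Perm (Fin n)) {i j k l : Fin n} (hij : i < j) (hkl : k < l) :
    tOp q π i l * tOp q π j k =
      Algebra.lmul ℂ (Mero n) (permMero π (gfun q i j)) * (tOp q π j k * tOp q π i l) +
      (Algebra.lmul ℂ (Mero n) (hfun q k l) - Algebra.lmul ℂ (Mero n) (permMero π (hfun q i j))) *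
        (tOp q π i k * tOp q π j l) := by
  rcases eq_and_eq_cases i j (π k) (π l) with ⟨rfl, rfl⟩ | ⟨rfl, rfl⟩ | ⟨h, h'⟩
  · rw [permMero_hfun, sub_self, zero_mul, add_zero,
      tOp_mul_tOp_of_not q fun h' => hij.ne h'.1, tOp_mul_tOp_of_not q fun h' => hij.ne h'.2, mul_zero]
  · rw [tOp_mul_tOp_of_not q (i := π l) (k := k) fun h' => hij.ne h'.1, mul_zero, add_zero,
      tOp_self, tOp_self, shiftOp_mul_swap hq₀ hl hkl hij, permMero_gfun, gfun_comm]
  · rw [tOp_mul_tOp_of_not q h', tOp_mul_tOp_of_not q fun h'' => h' h''.symm,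
      tOp_mul_tOp_of_not q h, mul_zero, mul_zero, add_zero]

theorem genOp_lam_t {n : ℕ} (q : ℂ) (π : Equiv.Perm (Fin n)) (f : Mero n) (i j : Fin n) :
    Algebra.lmul ℂ (Mero n) (permMero π f) * tOp q π i j =
      tOp q π i j * Algebra.lmul ℂ (Mero n) (permMero π (shift i f)) := by
  by_cases h : i = π j
  · rw [h, tOp_self, permMero_shift, lmul_mul_shiftOp]
  · rw [tOp_of_ne q h, mul_zero, zero_mul]

theorem genOp_mu_t {n : ℕ} (q : ℂ) (π : Equiv.Perm (Fin n)) (f : Mero n) (i j : Fin n) :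
    Algebra.lmul ℂ (Mero n) f * tOp q π i j =
      tOp q π i j * Algebra.lmul ℂ (Mero n) (shift j f) := by
  by_cases h : i = π j
  · rw [h, tOp_self, lmul_mul_shiftOp]
  · rw [tOp_of_ne q h, mul_zero, zero_mul]

theorem algHom_map_add {A B : Type*} [Ring A] [Ring B] [Algebra ℂ A] [Algebra ℂ B]
    (f : A →ₐ[ℂ] B) (x y : A) : f (x + y) = f x + f y := map_add f x y

theorem algHom_map_add_sub_mul {A B : Type*} [Ring A] [Ring B] [Algebra ℂ A] [Algebra ℂ B]
    (f : A →ₐ[ℂ] B) (a b c x y : A) :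
    f (a + (b - c) * (x * y)) = f a + (f b - f c) * (f x * f y) := by
  simp only [map_add, map_sub, map_mul]

theorem lift_genOp_rel {n : ℕ} {q : ℂ} (hq₀ : q ≠ 0) (hl : Complex.log q ≠ 0)
    (π : Equiv.Perm (Fin n)) ⦃x y : FreeAlgebra ℂ (Gen n)⦄ (h : Rel q x y) :
    FreeAlgebra.lift ℂ (genOp q π) x = FreeAlgebra.lift ℂ (genOp q π) y := by
  cases h with
  | lam_scalar c =>
    rw [FreeAlgebra.lift_ι_apply, AlgHom.commutes]
    change Algebra.lmul ℂ (Mero n) (permMero π _) = _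
    rw [permMero_const, AlgHom.commutes]
  | lam_add f₁ f₂ =>
    rw [algHom_map_add, FreeAlgebra.lift_ι_apply, FreeAlgebra.lift_ι_apply, FreeAlgebra.lift_ι_apply]
    change Algebra.lmul ℂ (Mero n) (permMero π _) = _
    rw [RingEquiv.map_add, algHom_map_add]
    rfl
  | lam_mul f₁ f₂ =>
    rw [map_mul, FreeAlgebra.lift_ι_apply, FreeAlgebra.lift_ι_apply, FreeAlgebra.lift_ι_apply]
    change Algebra.lmul ℂ (Mero n) (permMero π _) = _
    rw [RingEquiv.map_mul, map_mul]
    rfl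
  | mu_scalar c =>
    rw [FreeAlgebra.lift_ι_apply, AlgHom.commutes]
    exact AlgHom.commutes _ c
  | mu_add f₁ f₂ =>
    rw [algHom_map_add, FreeAlgebra.lift_ι_apply, FreeAlgebra.lift_ι_apply, FreeAlgebra.lift_ι_apply]
    exact algHom_map_add (Algebra.lmul ℂ (Mero n)) f₁ f₂
  | mu_mul f₁ f₂ =>
    rw [map_mul, FreeAlgebra.lift_ι_apply, FreeAlgebra.lift_ι_apply, FreeAlgebra.lift_ι_apply]
    exact map_mul (Algebra.lmul ℂ (Mero n)) f₁ f₂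
  | lam_mu f₁ f₂ =>
    simp only [map_mul, FreeAlgebra.lift_ι_apply]
    change Algebra.lmul ℂ (Mero n) (permMero π f₁) * Algebra.lmul ℂ (Mero n) f₂ =
      Algebra.lmul ℂ (Mero n) f₂ * Algebra.lmul ℂ (Mero n) (permMero π f₁)
    rw [← map_mul, ← map_mul, mul_comm]
  | lam_t f i j =>
    simp only [map_mul, FreeAlgebra.lift_ι_apply]
    exact genOp_lam_t q π f i j
  | mu_t f i j =>
    simp only [map_mul, FreeAlgebra.lift_ι_apply]
    exact genOp_mu_t q π f i j
  | rows i k l hkl =>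
    simp only [map_mul, FreeAlgebra.lift_ι_apply, genOp]
    rw [tOp_mul_tOp_of_not q fun h => hkl.ne (π.injective (h.1.symm.trans h.2)),
      tOp_mul_tOp_of_not q fun h => hkl.ne (π.injective (h.2.symm.trans h.1)), mul_zero]
  | cols i j k hij =>
    simp only [map_mul, FreeAlgebra.lift_ι_apply, genOp]
    rw [tOp_mul_tOp_of_not q fun h => hij.ne (h.2.trans h.1.symm),
      tOp_mul_tOp_of_not q fun h => hij.ne (h.1.trans h.2.symm), mul_zero]
  | rtt₁ i j k l hij hkl =>
    simp only [algHom_map_add_sub_mul, map_mul, FreeAlgebra.lift_ι_apply]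
    exact genOp_rtt₁ q π hij hkl
  | rtt₂ i j k l hij hkl =>
    simp only [algHom_map_add_sub_mul, map_mul, FreeAlgebra.lift_ι_apply]
    exact genOp_rtt₂ q π hij hkl
  | rtt₃ i j k l hij hkl =>
    simp only [algHom_map_add_sub_mul, map_mul, FreeAlgebra.lift_ι_apply]
    exact genOp_rtt₃ hq₀ hl π hij hkl
  | rtt₄ i j k l hij hkl =>
    simp only [algHom_map_add_sub_mul, map_mul, FreeAlgebra.lift_ι_apply]
    exact genOp_rtt₄ hq₀ hl π hij hkl

/-- The representation of the dynamical quantum matrix algebra attached to a permutation. -/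
def permRep {n : ℕ} {q : ℂ} (hq₀ : q ≠ 0) (hl : Complex.log q ≠ 0) (π : Equiv.Perm (Fin n)) :
    DynAlg n q →ₐ[ℂ] Module.End ℂ (Mero n) :=
  RingQuot.liftAlgHom ℂ ⟨FreeAlgebra.lift ℂ (genOp q π), lift_genOp_rel hq₀ hl π⟩

theorem permRep_t {n : ℕ} {q : ℂ} (hq₀ : q ≠ 0) (hl : Complex.log q ≠ 0)
    (π : Equiv.Perm (Fin n)) (i j : Fin n) : permRep hq₀ hl π (t q i j) = tOp q π i j :=
  (RingQuot.liftAlgHom_mkAlgHom_apply _ _ _ _).trans (FreeAlgebra.lift_ι_apply _ _)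

theorem isUnit_momL {n : ℕ} (q : ℂ) {f : Mero n} (hf : f ≠ 0) : IsUnit (momL q f) :=
  hf.isUnit.map (momLHom q)

theorem isUnit_momR {n : ℕ} (q : ℂ) {f : Mero n} (hf : f ≠ 0) : IsUnit (momR q f) :=
  hf.isUnit.map (momRHom q)

/-- In each expansion along a column `c` only the row `π c` survives, leaving a product of units. -/
theorem isUnit_permRep_qminor {n : ℕ} {q : ℂ} (hq₀ : q ≠ 0) (hl : Complex.log q ≠ 0)
    (π : Equiv.Perm (Fin n)) {I : Finset (Fin n)} {cs : List (Fin n)} (hcs : cs.Nodup)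
    (hI : cs.toFinset.image π = I) : IsUnit (permRep hq₀ hl π (qminor q I cs)) := by
  induction cs generalizing I with
  | nil =>
    rw [qminor, map_one]
    exact isUnit_one
  | cons c cs ih =>
    obtain ⟨hc, hcs⟩ := List.nodup_cons.mp hcs
    rw [List.toFinset_cons, Finset.image_insert] at hI
    have hcI : π c ∈ I := hI ▸ Finset.mem_insert_self _ _
    have hI' : cs.toFinset.image π = I.erase (π c) := by
      rw [← hI, Finset.erase_insert]
      simpa using hc
    rw [qminor, map_sum, Finset.sum_eq_single_of_mem _ hcI, map_mul, map_mul, permRep_t, tOp_self]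
    · exact (((isUnit_momL q (qsign_ne_zero hq₀ hl _ _)).map _).mul (ih hcs hI')).mul
        (isUnit_shiftOp hq₀ hl π c)
    · intro k _ hk
      rw [map_mul, permRep_t, tOp_of_ne q hk, mul_zero]

theorem setMinor_ne_zero {n : ℕ} {q : ℂ} (hq₀ : q ≠ 0) (hl : Complex.log q ≠ 0)
    {π : Equiv.Perm (Fin n)} {I J : Finset (Fin n)} (hIJ : J.image π = I) :
    setMinor q I J ≠ 0 := by
  intro h
  have h1 : IsUnit (permRep hq₀ hl π (setMinor q I J)) := by
    rw [setMinor, nminor, map_mul]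
    refine ((isUnit_momR q (inv_ne_zero (listSign_ne_zero hq₀ hl _))).map _).mul
      (isUnit_permRep_qminor hq₀ hl π (Finset.nodup_toList J) ?_)
    rwa [Finset.toList_toFinset]
  rw [h, map_zero] at h1
  exact not_isUnit_zero h1

/-! ### Quasideterminants of submatrices -/

section Quasideterminant

variable {n : ℕ} {q : ℂ} {K : Type*} [Ring K] (φ : DynAlg n q →+* K)

/-- The image in `K` of the submatrix of `T` with row set `I` and column set `J`. -/
def subMatrix (I J : Finset (Fin n)) : Matrix {a // a ∈ I} {b // b ∈ J} K :=
  Matrix.of fun a b => φ (t q a.1 b.1)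

/-- The image in `K` of the matrix of cofactors. -/
def cofactorMatrix (I J : Finset (Fin n)) : Matrix {b // b ∈ J} {a // a ∈ I} K :=
  Matrix.of fun b a => φ (cofactor q I J b.1 a.1)

theorem sum_map_cofactor_mul (hq₀ : q ≠ 0) (hl : Complex.log q ≠ 0) (I : Finset (Fin n))
    {J : Finset (Fin n)} {j l : Fin n} (hj : j ∈ J) (hlJ : l ∈ J) :
    ∑ a ∈ I, φ (cofactor q I J j a) * φ (t q a l) = if j = l then φ (setMinor q I J) else 0 := by
  simp only [← map_mul]
  rw [← map_sum]
  by_cases h : j = l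
  · rw [if_pos h, ← h, sum_cofactor_mul_t_self hq₀ hl I hj]
  · rw [if_neg h, sum_cofactor_mul_t_of_ne hq₀ hl I hlJ h, map_zero]

theorem cofactorMatrix_mul_subMatrix (hq₀ : q ≠ 0) (hl : Complex.log q ≠ 0)
    (I J : Finset (Fin n)) :
    cofactorMatrix φ I J * subMatrix φ I J = Matrix.diagonal fun _ => φ (setMinor q I J) := by
  ext j l
  rw [Matrix.mul_apply, Matrix.diagonal_apply]
  simp only [cofactorMatrix, subMatrix, Matrix.of_apply, Subtype.ext_iff]
  rw [← sum_map_cofactor_mul φ hq₀ hl I j.2 l.2]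
  exact Finset.sum_coe_sort I fun a => φ (cofactor q I J j a) * φ (t q a l)

/-- Multiplying the one-sided Laplace identity by the inverse `Y` on the right identifies the
cofactor matrix with the minor times `Y`. -/
theorem map_setMinor_eq_cofactor_mul (hq₀ : q ≠ 0) (hl : Complex.log q ≠ 0)
    {I J : Finset (Fin n)} {i j : Fin n} {hi : i ∈ I} {hj : j ∈ J} {x : K}
    (hx : IsQuasidet (subMatrix φ I J) ⟨i, hi⟩ ⟨j, hj⟩ x) :
    φ (setMinor q I J) = φ (cofactor q I J j i) * x := by
  obtain ⟨Y, hXY, -, hYx, -⟩ := hx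
  let D : Matrix {b // b ∈ J} {b // b ∈ J} K := Matrix.diagonal fun _ => φ (setMinor q I J)
  have h : cofactorMatrix φ I J = D * Y := by
    change _ = (Matrix.diagonal fun _ => φ (setMinor q I J) : Matrix {b // b ∈ J} _ K) * Y
    rw [← cofactorMatrix_mul_subMatrix φ hq₀ hl, Matrix.mul_assoc, hXY, Matrix.mul_one]
  have h1 : φ (cofactor q I J j i) = φ (setMinor q I J) * Y ⟨j, hj⟩ ⟨i, hi⟩ := by
    have h2 := congrFun (congrFun h ⟨j, hj⟩) ⟨i, hi⟩
    rwa [Matrix.diagonal_mul] at h2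
  rw [h1, mul_assoc, hYx, mul_one]

/-! ### Left independence of rows and two-sided inverses. -/

/-- The rows in `I` of the columns `J` of `T` are left linearly independent over `K`. -/
def RowsIndependent (I J : Finset (Fin n)) : Prop :=
  ∀ f : Fin n → K, (∀ b ∈ J, ∑ a ∈ I, f a * φ (t q a b) = 0) → ∀ a ∈ I, f a = 0

theorem RowsIndependent.of_erase {φ : DynAlg n q →+* K} (hq₀ : q ≠ 0) (hl : Complex.log q ≠ 0)
    {I J : Finset (Fin n)} {i j : Fin n} (hi : i ∈ I) (hj : j ∈ J)
    (h : RowsIndependent φ (I.erase i) (J.erase j)) (hu : IsUnit (φ (cofactor q I J j i)))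
    (hN : IsUnit (φ (setMinor q I J))) : RowsIndependent φ I J := by
  intro f hf
  obtain ⟨u, hu⟩ := hu
  -- The multiple of the cofactor row is chosen to cancel the coefficient at `i`. It kills every
  -- column except `j`, so the induction hypothesis applies to the difference.
  have hsum : ∀ b ∈ J, ∑ a ∈ I, (f a - f i * ↑u⁻¹ * φ (cofactor q I J j a)) * φ (t q a b) =
      -(f i * ↑u⁻¹ * if j = b then φ (setMinor q I J) else 0) := by
    intro b hb
    simp only [sub_mul, mul_assoc]
    rw [Finset.sum_sub_distrib, hf b hb, ← Finset.mul_sum, ← Finset.mul_sum,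
      sum_map_cofactor_mul φ hq₀ hl I hj hb, zero_sub]
  have hgi : f i - f i * ↑u⁻¹ * φ (cofactor q I J j i) = 0 := by
    rw [← hu, Units.inv_mul_cancel_right, sub_self]
  have hg : ∀ a ∈ I, f a - f i * ↑u⁻¹ * φ (cofactor q I J j a) = 0 := by
    intro a ha
    by_cases hai : a = i
    · rw [hai, hgi]
    · refine h (fun a => f a - f i * ↑u⁻¹ * φ (cofactor q I J j a)) (fun b hb => ?_) a
        (Finset.mem_erase.mpr ⟨hai, ha⟩)
      have h1 := hsum b (Finset.mem_of_mem_erase hb)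
      rw [if_neg (Finset.ne_of_mem_erase hb).symm, mul_zero, neg_zero,
        ← Finset.add_sum_erase I _ hi, hgi, zero_mul, zero_add] at h1
      exact h1
  -- Now `f` is a multiple of the cofactor row; column `j` pairs that row to the invertible minor,
  -- so the multiplier `f i * ↑u⁻¹` is zero.
  have h2 := hsum j hj
  rw [Finset.sum_eq_zero fun a ha => by rw [hg a ha, zero_mul], if_pos rfl, eq_comm, neg_eq_zero,
    hN.mul_left_eq_zero] at h2
  intro a ha
  have h3 := hg a ha
  rwa [h2, zero_mul, sub_zero] at h3

theorem RowsIndependent.exists_isQuasidet {φ : DynAlg n q →+* K} (hq₀ : q ≠ 0)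
    (hl : Complex.log q ≠ 0) {I J : Finset (Fin n)} (h : RowsIndependent φ I J) {i j : Fin n}
    (hi : i ∈ I) (hj : j ∈ J) (hu : IsUnit (φ (cofactor q I J j i)))
    (hN : IsUnit (φ (setMinor q I J))) :
    ∃ d, IsQuasidet (subMatrix φ I J) ⟨i, hi⟩ ⟨j, hj⟩ d := by
  obtain ⟨N, hN⟩ := hN
  let D : Matrix {b // b ∈ J} {b // b ∈ J} K := Matrix.diagonal fun _ => ↑N⁻¹
  let Y : Matrix {b // b ∈ J} {a // a ∈ I} K := D * cofactorMatrix φ I J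
  have hYX : Y * subMatrix φ I J = 1 := by
    rw [Matrix.mul_assoc, cofactorMatrix_mul_subMatrix φ hq₀ hl, Matrix.diagonal_mul_diagonal,
      ← hN, Units.inv_mul, Matrix.diagonal_one]
  have hYji : Y ⟨j, hj⟩ ⟨i, hi⟩ = ↑N⁻¹ * φ (cofactor q I J j i) := Matrix.diagonal_mul _ _ _ _
  obtain ⟨d, hd⟩ : IsUnit (Y ⟨j, hj⟩ ⟨i, hi⟩) := hYji ▸ N⁻¹.isUnit.mul hu
  refine ⟨↑d⁻¹, Y, ?_, hYX, by rw [← hd, Units.mul_inv], by rw [← hd, Units.inv_mul]⟩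
  -- Each row of this defect of the left inverse `Y` is a left linear relation among the rows of the
  -- submatrix, hence zero.
  let F : Matrix {a // a ∈ I} {a // a ∈ I} K := 1 - subMatrix φ I J * Y
  have hF : F * subMatrix φ I J = 0 := by
    rw [Matrix.sub_mul, Matrix.mul_assoc, hYX, Matrix.mul_one, Matrix.one_mul, sub_self]
  rw [eq_comm, ← sub_eq_zero]
  ext r a
  have h1 := h (fun a => if ha : a ∈ I then F r ⟨a, ha⟩ else 0)
    (fun b hb => ?_) a.1 a.2
  · rw [dif_pos a.2] at h1
    exact h1
  · have h2 := congrFun (congrFun hF r) ⟨b, hb⟩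
    rw [Matrix.mul_apply, Matrix.zero_apply] at h2
    rw [← h2, ← Finset.sum_coe_sort]
    refine Finset.sum_congr rfl fun a _ => ?_
    rw [dif_pos a.2]
    rfl

end Quasideterminant

/-! ### The factorization of the determinant -/

/-- `{σ(m+1), …, σ(n)}`. -/
def tailSet {n : ℕ} (σ : Equiv.Perm (Fin n)) (m : ℕ) : Finset (Fin n) :=
  Finset.univ.filter fun a => m ≤ (σ.symm a : ℕ)

theorem mem_tailSet {n : ℕ} {σ : Equiv.Perm (Fin n)} {m : ℕ} {a : Fin n} :
    a ∈ tailSet σ m ↔ m ≤ (σ.symm a : ℕ) := by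
  simp [tailSet]

/-- Indexing by natural numbers adds the empty set at index `n`, where the recursion ends. -/
theorem remaining_eq_tailSet {n : ℕ} (σ : Equiv.Perm (Fin n)) (k : Fin n) :
    remaining σ k = tailSet σ k := by
  ext a
  rw [remaining, mem_tailSet, Finset.mem_map_equiv, Finset.mem_Ici, Fin.le_def]

theorem compl_initialSet {n : ℕ} (σ : Equiv.Perm (Fin n)) (k : Fin n) :
    (initialSet σ k)ᶜ = tailSet σ (k + 1) := by
  ext a
  rw [initialSet, mem_tailSet, Finset.mem_compl, Finset.mem_map_equiv, Finset.mem_Iic, not_le,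
    Fin.lt_def, Nat.lt_iff_add_one_le]

theorem tailSet_erase {n : ℕ} (σ : Equiv.Perm (Fin n)) (k : Fin n) :
    (tailSet σ k).erase (σ k) = tailSet σ (k + 1) := by
  ext a
  rw [Finset.mem_erase, mem_tailSet, mem_tailSet, Ne, ← Equiv.symm_apply_eq, Fin.ext_iff]
  omega

theorem tailSet_zero {n : ℕ} (σ : Equiv.Perm (Fin n)) : tailSet σ 0 = Finset.univ := by
  ext a
  simp [mem_tailSet]

theorem tailSet_self {n : ℕ} (σ : Equiv.Perm (Fin n)) : tailSet σ n = ∅ := by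
  ext a
  simp [mem_tailSet]

theorem image_tailSet {n : ℕ} (σ τ : Equiv.Perm (Fin n)) (m : ℕ) :
    (tailSet τ m).image (τ.symm.trans σ) = tailSet σ m := by
  ext a
  rw [Finset.mem_image, mem_tailSet]
  constructor
  · rintro ⟨b, hb, rfl⟩
    simpa [mem_tailSet] using hb
  · intro ha
    exact ⟨τ (σ.symm a), by simpa [mem_tailSet] using ha, by simp⟩

theorem setMinor_empty {n : ℕ} (q : ℂ) (I : Finset (Fin n)) : setMinor q I ∅ = 1 := by
  simp [setMinor, nminor, qminor, listSign, momR_one]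

/-- The functions collect on the left and the `d k` on the right, so only functions of `λ` and `μ`
have to be commuted. -/
theorem eq_mul_prod_of_recursion {n m : ℕ} {q : ℂ} {K : Type*} [Ring K] (φ : DynAlg n q →+* K)
    (l r : Fin m → Mero n) (d : Fin m → K) (a : ℕ → K)
    (h : ∀ k : Fin m, a k = φ (momR q (r k)⁻¹ * momL q (l k)) * a (k + 1) * d k) :
    a 0 = φ (momL q (∏ k, l k) * momR q (∏ k, r k)⁻¹) * a m * (List.ofFn d).reverse.prod := by
  induction m generalizing a with
  | zero => simp [momL_one, momR_one]
  | succ m ih =>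
    have h0 := h 0
    have h1 := ih (fun k => l k.succ) (fun k => r k.succ) (fun k => d k.succ)
      (fun k => a (k + 1)) fun k => h k.succ
    have h2 : momR q (r 0)⁻¹ * momL q (l 0) *
        (momL q (∏ k : Fin m, l k.succ) * momR q (∏ k : Fin m, r k.succ)⁻¹) =
        momL q (∏ k, l k) * momR q (∏ k, r k)⁻¹ := by
      rw [Fin.prod_univ_succ, Fin.prod_univ_succ, mul_inv, momL_mul, momR_mul, mul_assoc,
        ← mul_assoc (momL q (l 0)), ← mul_assoc, ← momL_mul, ← momL_mul_momR, mul_assoc]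
    simp only [zero_add] at h1
    rw [Fin.val_zero, zero_add, h1] at h0
    rw [h0, ← h2, map_mul φ (_ * _), List.ofFn_succ, List.reverse_cons, List.prod_append,
      List.prod_singleton]
    simp only [mul_assoc]

theorem rowsIndependent_tailSet {n : ℕ} {q : ℂ} (hq₀ : q ≠ 0) (hl : Complex.log q ≠ 0)
    (σ τ : Equiv.Perm (Fin n)) {K : Type*} [Ring K] {φ : DynAlg n q →+* K}
    (hN : ∀ m, IsUnit (φ (setMinor q (tailSet σ m) (tailSet τ m))))
    (hu : ∀ k : Fin n, IsUnit (φ (cofactor q (tailSet σ k) (tailSet τ k) (τ k) (σ k))))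
    {m : ℕ} (hm : m ≤ n) : RowsIndependent φ (tailSet σ m) (tailSet τ m) := by
  induction hm using Nat.decreasingInduction with
  | self =>
    rw [tailSet_self]
    intro f _ a ha
    exact absurd ha (Finset.notMem_empty a)
  | of_succ k hk ih =>
    refine RowsIndependent.of_erase hq₀ hl (mem_tailSet.mpr ?_) (mem_tailSet.mpr ?_) ?_
      (hu ⟨k, hk⟩) (hN k)
    · rw [Equiv.symm_apply_apply]
    · rw [Equiv.symm_apply_apply]
    · rw [tailSet_erase σ ⟨k, hk⟩, tailSet_erase τ ⟨k, hk⟩]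
      exact ih

end

end DynDet

/-! ### Existence of the quasideterminants and the product formula. -/

theorem mainTheorem5 (n : ℕ) (q : ℂ) (hq₀ : q ≠ 0) (hq : ∀ m : ℕ, 0 < m → q ^ m ≠ 1)
    (σ τ ρ : Equiv.Perm (Fin n)) {K : Type*} [Ring K] (φ : DynDet.DynAlg n q →+* K) :
    ((∀ a : DynDet.DynAlg n q, a ≠ 0 → IsUnit (φ a)) →
      ∀ k : Fin n, ∃ d : K, DynDet.IsStepQuasidet φ σ τ k d) ∧
    ∀ d : Fin n → K, (∀ k : Fin n, DynDet.IsStepQuasidet φ σ τ k (d k)) →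
      φ (DynDet.dynDet q ρ) = φ (DynDet.prefactor q σ τ) * (List.ofFn d).reverse.prod := by
  have hl := DynDet.log_ne_zero_of_pow_ne_one hq₀ hq
  have hcof : ∀ k : Fin n,
      DynDet.cofactor q (DynDet.remaining σ k) (DynDet.remaining τ k) (τ k) (σ k) =
        DynDet.momR q (DynDet.qsign q (DynDet.initialSet τ k)ᶜ {τ k})⁻¹ *
          DynDet.momL q (DynDet.qsign q (DynDet.initialSet σ k)ᶜ {σ k}) *
          DynDet.setMinor q (DynDet.tailSet σ (k + 1)) (DynDet.tailSet τ (k + 1)) := by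
    intro k
    rw [DynDet.cofactor, DynDet.remaining_eq_tailSet, DynDet.remaining_eq_tailSet,
      DynDet.tailSet_erase, DynDet.tailSet_erase, DynDet.compl_initialSet,
      DynDet.compl_initialSet]
  constructor
  · intro hφ k
    have hN : ∀ m, IsUnit
        (φ (DynDet.setMinor q (DynDet.tailSet σ m) (DynDet.tailSet τ m))) := fun m =>
      hφ _ (DynDet.setMinor_ne_zero hq₀ hl (DynDet.image_tailSet σ τ m))
    have hu : ∀ k : Fin n, IsUnit
        (φ (DynDet.cofactor q (DynDet.remaining σ k) (DynDet.remaining τ k) (τ k) (σ k))) := by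
      intro k
      rw [hcof, map_mul, map_mul]
      exact (((DynDet.isUnit_momR q (inv_ne_zero (DynDet.qsign_ne_zero hq₀ hl _ _))).map φ).mul
        ((DynDet.isUnit_momL q (DynDet.qsign_ne_zero hq₀ hl _ _)).map φ)).mul (hN (k + 1))
    have hfree := DynDet.rowsIndependent_tailSet hq₀ hl σ τ hN
      (fun k => by simpa only [DynDet.remaining_eq_tailSet] using hu k) k.2.le
    rw [← DynDet.remaining_eq_tailSet, ← DynDet.remaining_eq_tailSet] at hfree
    exact hfree.exists_isQuasidet hq₀ hl (DynDet.mem_remaining σ k) (DynDet.mem_remaining τ k)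
      (hu k) (by simpa only [DynDet.remaining_eq_tailSet] using hN k)
  · intro d hd
    have h := DynDet.eq_mul_prod_of_recursion φ
      (fun k => DynDet.qsign q (DynDet.initialSet σ k)ᶜ {σ k})
      (fun k => DynDet.qsign q (DynDet.initialSet τ k)ᶜ {τ k}) d
      (fun m => φ (DynDet.setMinor q (DynDet.tailSet σ m) (DynDet.tailSet τ m))) fun k => by
        rw [← map_mul, ← hcof k]
        simpa only [DynDet.remaining_eq_tailSet] using
          DynDet.map_setMinor_eq_cofactor_mul φ hq₀ hl (hd k)
    -- The sequence of minors starts at the full minor, which is the determinant for every `ρ`, and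
    -- ends at the minor without columns, which is 1.
    rw [DynDet.tailSet_zero, DynDet.tailSet_zero, DynDet.tailSet_self τ, DynDet.setMinor_empty,
      map_one, mul_one] at h
    rw [DynDet.dynDet_eq_setMinor hq₀ hl ρ, h]
    rfl
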